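/- **Setting.** On $\mathbb{R}^{3}\times[0,T)$, $0<T<\infty$, with coordinates $x^0=t$, $x^1,x^2,x^3$ and $x_0=-t$, $x_i=x^i$, let $r=|x|$, $q=|x|-t$, and let $$\mathfrak{L}=\{\partial_\alpha,\ \Omega_{\alpha\beta}=-x_\alpha\partial_\beta+x_\beta\partial_\alpha,\ \tilde S=t\partial_t+r\partial_r\},\qquad \alpha,\beta\in\{0,1,2,3\}.$$ For $I=(\iota_1,\dots,\iota_k)$, $|I|=k$, let $Z^I=Z^{\iota_1}\cdots Z^{\iota_k}$ be a product of $k$ fields of $\mathfrak{L}$, acting on the components of tensors. Let $\partial p=(\partial_\alpha p)_{\alpha=0,\dots,3}$, and for $x\neq0$ let $\bar\partial p=(\bar\partial_\alpha p)_{\alpha=0,\dots,3}$, where $\bar\partial_0=\partial_t+\partial_r$ and $\bar\partial_i=\partial_i-\frac{x_i}{r}\partial_r$. The norm of a tensor is the Euclidean norm of its components; $\mathfrak{su}(2)$ carries the norm of the invariant inner product $\langle X,Y\rangle=-\mathrm{tr}(XY)$, and $|\Phi|^2=\Phi^\dagger\Phi$. Fix $\gamma,\mu\in(0,1/2)$ and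 an integer $N\ge 4$. Put $w(q)=1+(1+|q|)^{1+2\gamma}$ for $q>0$ and $w(q)=1+(1+|q|)^{-2\mu}$ for $q<0$. Let $E_{s}(T)=\bigcap_{0\le k\le s}C^{s-k}([0,T),H_k(\mathbb{R}^3))$. For a 2-tensor $h$, an $\mathfrak{su}(2)$-valued 1-form $A$ and a $\mathbb{C}^2$-valued function $\Phi$ of class $E_{N+1}(T)$, let $$\mathcal{E}_N(t)=\sum_{|I|\le N}\Big(\|\sqrt w\,\partial Z^Ih(\cdot,t)\|_{L^2(\mathbb{R}^3)}+\|\sqrt w\,\partial Z^IA(\cdot,t)\|_{L^2(\mathbb{R}^3)}+\|\sqrt w\,\partial Z^I\Phi(\cdot,t)\|_{L^2(\mathbb{R}^3)}\Big).$$ **Theorem 5.1.** For all $N,\gamma,\mu$ as above, all $T\in(0,\infty)$ and all $C>0$ there is a constant $K>0$, depending only on $N,\gamma,\mu,T,C$, such that the following holds for all $\varepsilon>0$ and $T^*\in(0,T]$. Let $h,A,\Phi$ be of class $E_{N+1}(T)$ (for instance $h=g-m$, with $m$ the Minkowski metric, and $(g,A,\Phi)$ a solution of the $\mathfrak{su}(2)$-Einstein–Yang–Mills–Higgs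 system in this class) and suppose that $$\mathcal{E}_N(t)\le 2C\varepsilon\qquad\text{for all }t\in[0,T^*).$$ Then for every $t\in[0,T^*)$ and every $I$ with $|I|\le N-3$, the functions $Z^Ih$, $Z^IA$, $Z^I\Phi$, $\partial Z^Ih$, $\partial Z^IA$, $\partial Z^I\Phi$ at time $t$ have continuous representatives on $\mathbb{R}^3$, and for these, at every $x\in\mathbb{R}^3$, $$|\partial Z^Ih|+|\partial Z^IA|+|\partial Z^I\Phi|\le\begin{cases}K\varepsilon(1+|q|)^{-2-\gamma},&q>0,\\ K\varepsilon(1+|q|)^{-3/2},&q<0,\end{cases}$$ $$|Z^Ih|+|Z^IA|+|Z^I\Phi|\le\begin{cases}K\varepsilon(1+|q|)^{-1-\gamma},&q>0,\\ K\varepsilon(1+|q|)^{-1/2},&q<0.\end{cases}$$ If moreover $|I|\le N-4$, then for every $x\ne0$ $$|\bar\partial Z^Ih|+|\bar\partial Z^IA|+|\bar\partial Z^I\Phi|\le\begin{cases}K\varepsilon(1+|q|)^{-2-\gamma},&q>0,\\ K\varepsilon(1+|q|)^{-3/2},&q<0.\end{cases}$$ -/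

import Mathlib

open MeasureTheory
open scoped ContDiff

noncomputable section

namespace EYMH

/-- The space slice `ℝ³` with its Euclidean norm. -/
abbrev Space : Type := EuclideanSpace ℝ (Fin 3)

/-! ### The values of the fields -/

/-- Covariant 2-tensors at a point, by their components, with `|p|² = ∑ (p_{αβ})²`. -/
abbrev Tensor2 : Type := EuclideanSpace ℝ (Fin 4 × Fin 4)

/-- The traceless skew-Hermitian complex `2 × 2` matrices. -/
def su2Matrices : Submodule ℝ (Matrix (Fin 2) (Fin 2) ℂ) where
  carrier := {X | X.conjTranspose = -X ∧ X.trace = 0}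
  add_mem' := by
    rintro X Y ⟨hX, hX'⟩ ⟨hY, hY'⟩
    refine ⟨?_, ?_⟩
    · rw [Matrix.conjTranspose_add, hX, hY, neg_add]
    · rw [Matrix.trace_add, hX', hY', add_zero]
  zero_mem' := by
    refine ⟨?_, ?_⟩
    · rw [Matrix.conjTranspose_zero, neg_zero]
    · exact Matrix.trace_zero _ _
  smul_mem' := by
    rintro c X ⟨hX, hX'⟩
    refine ⟨?_, ?_⟩
    · rw [Matrix.conjTranspose_smul, hX, star_trivial, smul_neg]
    · rw [Matrix.trace_smul, hX', smul_zero]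

/-- The Lie algebra `𝔰𝔲(2)`. -/
def su2 : Type := su2Matrices

section Frobenius

attribute [local instance] Matrix.frobeniusNormedAddCommGroup Matrix.frobeniusNormedSpace

/-- The Frobenius norm on `𝔰𝔲(2)`: the norm of the invariant inner product
`⟨X, Y⟩ = - tr (X Y)`. -/
instance : NormedAddCommGroup su2 := Submodule.normedAddCommGroup su2Matrices

instance : NormedSpace ℝ su2 := Submodule.normedSpace su2Matrices

instance : FiniteDimensional ℝ su2 :=
  FiniteDimensional.finiteDimensional_submodule su2Matrices

end Frobenius

/-- `𝔰𝔲(2)`-valued covectors at a point, by their components, with `|A|² = ∑ |A_α|²`. -/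
abbrev GaugeForm : Type := PiLp 2 (fun _ : Fin 4 => su2)

/-- Values of the Higgs field, with `|Φ|² = Φ† Φ`. -/
abbrev Higgs : Type := EuclideanSpace ℂ (Fin 2)

section Sobolev

variable {W : Type} [NormedAddCommGroup W] [NormedSpace ℝ W]

/-! ### Sobolev spaces on `ℝ³` -/

/-- `L²(ℝ³; W)`. -/
abbrev L2 (W : Type) [NormedAddCommGroup W] : Type := Lp W 2 (volume : Measure Space)

/-- `g` is the weak partial derivative `∂ᵢ f` on `ℝ³`. -/
def IsWeakPartial (i : Fin 3) (f g : L2 W) : Prop :=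
  ∀ φ : Space → ℝ, ContDiff ℝ ∞ φ → HasCompactSupport φ →
    ∫ x, (fderiv ℝ φ x (EuclideanSpace.single i 1)) • f x = -∫ x, φ x • g x

/-- Spatial multi-indices of order at most `k`. -/
abbrev MultiIndex (k : ℕ) : Type := {b : Fin 3 → ℕ // ∑ i, b i ≤ k}

instance (k : ℕ) : Finite (MultiIndex k) :=
  Finite.of_injective
    (fun b : MultiIndex k => fun i : Fin 3 =>
      (⟨b.1 i, Nat.lt_succ_of_le
        ((Finset.single_le_sum (fun _ _ => Nat.zero_le _) (Finset.mem_univ i)).trans b.2)⟩ :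
        Fin (k + 1)))
    (fun _ _ hbc => Subtype.ext (funext fun i => congrArg Fin.val (congrFun hbc i)))

instance (k : ℕ) : Fintype (MultiIndex k) := Fintype.ofFinite _

lemma isWeakPartial_zero (i : Fin 3) : IsWeakPartial i (0 : L2 W) 0 := by
  intro φ _ _
  have h : ((0 : L2 W) : Space → W) =ᵐ[volume] 0 := Lp.coeFn_zero _ _ _
  rw [integral_eq_zero_of_ae, integral_eq_zero_of_ae, neg_zero]
  · filter_upwards [h] with x hx
    rw [hx, Pi.zero_apply, smul_zero]
  · filter_upwards [h] with x hx
    rw [hx, Pi.zero_apply, smul_zero]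

lemma integrable_test_smul {ψ : Space → ℝ} (hψ : Continuous ψ) (hc : HasCompactSupport ψ)
    (f : L2 W) : Integrable (fun x => ψ x • f x) := by
  have h1 : MemLp ψ 2 (volume : Measure Space) := hψ.memLp_of_hasCompactSupport hc
  exact memLp_one_iff_integrable.1 ((Lp.memLp f).smul h1)

lemma integrable_fderiv_smul {φ : Space → ℝ} (hφ : ContDiff ℝ ∞ φ) (hc : HasCompactSupport φ)
    (v : Space) (f : L2 W) : Integrable (fun x => (fderiv ℝ φ x v) • f x) := by
  refine integrable_test_smul (ψ := fun x => fderiv ℝ φ x v) ?_ ?_ f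
  · exact (hφ.continuous_fderiv (by simp)).clm_apply continuous_const
  · exact hc.fderiv_apply (𝕜 := ℝ) v

lemma IsWeakPartial.add {i : Fin 3} {f f' g g' : L2 W} (h : IsWeakPartial i f g)
    (h' : IsWeakPartial i f' g') : IsWeakPartial i (f + f') (g + g') := by
  intro φ hφ hc
  have e1 : (fun x => (fderiv ℝ φ x (EuclideanSpace.single i 1)) • (f + f' : L2 W) x) =ᵐ[volume]
      fun x => (fderiv ℝ φ x (EuclideanSpace.single i 1)) • f x +
        (fderiv ℝ φ x (EuclideanSpace.single i 1)) • f' x := by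
    filter_upwards [Lp.coeFn_add f f'] with x hx
    rw [hx, Pi.add_apply, smul_add]
  have e2 : (fun x => φ x • (g + g' : L2 W) x) =ᵐ[volume]
      fun x => φ x • g x + φ x • g' x := by
    filter_upwards [Lp.coeFn_add g g'] with x hx
    rw [hx, Pi.add_apply, smul_add]
  rw [integral_congr_ae e1, integral_congr_ae e2,
    integral_add (integrable_fderiv_smul hφ hc _ f) (integrable_fderiv_smul hφ hc _ f'),
    integral_add (integrable_test_smul hφ.continuous hc g)
      (integrable_test_smul hφ.continuous hc g'), h φ hφ hc, h' φ hφ hc, neg_add]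

lemma IsWeakPartial.smul {i : Fin 3} {f g : L2 W} (c : ℝ) (h : IsWeakPartial i f g) :
    IsWeakPartial i (c • f) (c • g) := by
  intro φ hφ hc
  have e1 : (fun x => (fderiv ℝ φ x (EuclideanSpace.single i 1)) • (c • f : L2 W) x) =ᵐ[volume]
      fun x => c • ((fderiv ℝ φ x (EuclideanSpace.single i 1)) • f x) := by
    filter_upwards [Lp.coeFn_smul c f] with x hx
    rw [hx, Pi.smul_apply, smul_comm]
  have e2 : (fun x => φ x • (c • g : L2 W) x) =ᵐ[volume] fun x => c • (φ x • g x) := by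
    filter_upwards [Lp.coeFn_smul c g] with x hx
    rw [hx, Pi.smul_apply, smul_comm]
  rw [integral_congr_ae e1, integral_congr_ae e2, integral_smul, integral_smul, h φ hφ hc,
    smul_neg]

/-- The Sobolev space `H_k(ℝ³; W)`: a function of `L²` together with its weak derivatives of order
at most `k`, all of them in `L²` (they are determined by the function).  The norm is the maximum of
the `L²` norms of these derivatives, which is equivalent to the usual one. -/
def sobolevH (k : ℕ) (W : Type) [NormedAddCommGroup W] [NormedSpace ℝ W] :
    Submodule ℝ (MultiIndex k → L2 W) where
  carrier := {F | ∀ (b c : MultiIndex k) (i : Fin 3), c.1 = b.1 + Pi.single i 1 →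
    IsWeakPartial i (F b) (F c)}
  add_mem' := fun hF hG b c i h => (hF b c i h).add (hG b c i h)
  zero_mem' := fun _ _ i _ => isWeakPartial_zero i
  smul_mem' := fun r _ hF b c i h => (hF b c i h).smul r

/-- The function underlying an element of `H_k`: its derivative of order `0`. -/
def sobolevH.toL2 {k : ℕ} (F : sobolevH k W) : L2 W := F.1 ⟨0, by simp⟩

/-- The space `E_s(T) = ⋂_{0 ≤ k ≤ s} C^{s-k}([0,T), H_k(ℝ³))`; the derivative in `t` is one-sided
at `t = 0`. -/
def MemE (s : ℕ) (T : ℝ) (u : ℝ → L2 W) : Prop :=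
  ∀ k : ℕ, k ≤ s → ∃ U : ℝ → sobolevH k W,
    ContDiffOn ℝ ((s - k : ℕ) : WithTop ℕ∞) U (Set.Ico 0 T) ∧
      ∀ t ∈ Set.Ico 0 T, sobolevH.toL2 (U t) = u t

/-! ### Derivatives of the fields -/

open Classical in
/-- The weak partial derivative `∂ᵢ f` in `L²` (and `0` if there is none). -/
def weakPartial (i : Fin 3) (f : L2 W) : L2 W :=
  if h : ∃ g, IsWeakPartial i f g then h.choose else 0

/-- The weak derivative `∂₁^{b₁} ∂₂^{b₂} ∂₃^{b₃} f`. -/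
def weakDeriv (b : Fin 3 → ℕ) (f : L2 W) : L2 W :=
  (weakPartial 0)^[b 0] ((weakPartial 1)^[b 1] ((weakPartial 2)^[b 2] f))

/-- A family of functions on `ℝ³` indexed by spacetime multi-indices `a = (a₀, a₁, a₂, a₃)`; the
member `a` stands for the value at a fixed time of `∂_t^{a₀} ∂₁^{a₁} ∂₂^{a₂} ∂₃^{a₃} v`, and the
member `0` for the value of `v` itself. -/
abbrev Jet (W : Type) : Type := (Fin 4 → ℕ) → Space → W

/-- All spacetime derivatives of `u` at the time `t ∈ [0,T)`. -/
def jetAt (T : ℝ) (u : ℝ → L2 W) (t : ℝ) : Jet W := fun a =>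
  weakDeriv (fun i => a i.succ) (iteratedDerivWithin (a 0) u (Set.Ico 0 T) t)

/-- The coordinates `x⁰ = t, x¹, x², x³` of the point `(x, t)`. -/
def coord (t : ℝ) (x : Space) : Fin 4 → ℝ := Fin.cons t (fun i => x i)

/-- The diagonal entries of the Minkowski metric, so that `x_α = m_{αα} x^α`. -/
def mink : Fin 4 → ℝ := Fin.cons (-1) (fun _ => 1)

/-- The family of derivatives of `∂_α v`. -/
def Jet.partial (α : Fin 4) (v : Jet W) : Jet W := fun a => v (a + Pi.single α 1)

/-- The family of derivatives of `x^α v`, by the Leibniz rule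
`∂^a (x^α v) = x^α ∂^a v + a_α ∂^{a - e_α} v`. -/
def Jet.mulCoord (t : ℝ) (α : Fin 4) (v : Jet W) : Jet W := fun a x =>
  coord t x α • v a x + (a α : ℝ) • v (a - Pi.single α 1) x

/-- Names for the members of the family `𝔏`. -/
inductive VF : Type
  /-- the translation `∂_α` -/
  | d (α : Fin 4)
  /-- the field `Ω_{αβ} = - x_α ∂_β + x_β ∂_α` -/
  | Ω (α β : Fin 4)
  /-- the scaling `t ∂_t + r ∂_r = ∑ x^α ∂_α` -/
  | S

/-- `VF` as a sum type. -/
def VF.equivSum : VF ≃ (Fin 4 ⊕ Fin 4 × Fin 4) ⊕ Unit where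
  toFun
    | .d α => .inl (.inl α)
    | .Ω α β => .inl (.inr (α, β))
    | .S => .inr ()
  invFun
    | .inl (.inl α) => .d α
    | .inl (.inr (α, β)) => .Ω α β
    | .inr _ => .S
  left_inv := by rintro (_ | _ | _) <;> rfl
  right_inv := by rintro ((_ | _) | _) <;> rfl

instance : Fintype VF := Fintype.ofEquiv _ VF.equivSum.symm

/-- The action of a vector field of `𝔏`, on the components of the field. -/
def VF.act (t : ℝ) : VF → Jet W → Jet W
  | .d α, v => v.partial α
  | .Ω α β, v => -(mink α • (v.partial β).mulCoord t α) + mink β • (v.partial α).mulCoord t β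
  | .S, v => ∑ α : Fin 4, (v.partial α).mulCoord t α

/-- The family of derivatives of `Z^I u = Z^{ι₁} ⋯ Z^{ι_k} u` at the time `t`, where
`I = (ι₁, …, ι_k)`. -/
def zJet (T : ℝ) (u : ℝ → L2 W) (I : List VF) (t : ℝ) : Jet W :=
  I.foldr (VF.act t) (jetAt T u t)

/-- `Z^I u (·, t)`. -/
def zField (T : ℝ) (u : ℝ → L2 W) (I : List VF) (t : ℝ) : Space → W :=
  zJet T u I t 0

/-- Values of `∂p`: the components `∂_α p`, `α = 0, …, 3`, with `|∂p|² = ∑ |∂_α p|²`. -/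
abbrev Grad (W : Type) : Type := PiLp 2 (fun _ : Fin 4 => W)

/-- `∂ Z^I u (·, t)`. -/
def zGrad (T : ℝ) (u : ℝ → L2 W) (I : List VF) (t : ℝ) : Space → Grad W := fun x =>
  WithLp.toLp 2 (fun α => zJet T u I t (Pi.single α 1) x)

/-- The radial derivative `∂_r p = ∑ ω_j ∂_j p` with `ω = x / |x|`, computed from `G = ∂p`. -/
def radial (x : Space) (G : Grad W) : W := ∑ j : Fin 3, (x j / ‖x‖) • G j.succ

/-- `∂̄p` at a point `x ≠ 0`, computed from `G = ∂p`: the components are `∂̄₀ = ∂_t + ∂_r` and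
`∂̄ᵢ = ∂ᵢ - ωᵢ ∂_r`. -/
def tangential (x : Space) (G : Grad W) : Grad W :=
  WithLp.toLp 2 (Fin.cons (G 0 + radial x G)
    (fun i : Fin 3 => G i.succ - (x i / ‖x‖) • radial x G) : Fin 4 → W)

/-! ### The energy -/

/-- The weight `w(q)`. -/
def weight (γ μ q : ℝ) : ℝ :=
  if 0 < q then 1 + (1 + |q|) ^ (1 + 2 * γ) else 1 + (1 + |q|) ^ (-2 * μ)

/-- `‖√w ∂Z^I u(·,t)‖_{L²}` with `w = w(|x| - t)`. -/
def weightedNorm (γ μ T : ℝ) (u : ℝ → L2 W) (I : List VF) (t : ℝ) : ENNReal :=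
  eLpNorm (fun x : Space => √(weight γ μ (‖x‖ - t)) • zGrad T u I t x) 2 volume

/-- `f` is a continuous function which agrees almost everywhere with `g`. -/
def IsContVersion {X : Type} [TopologicalSpace X] (f g : Space → X) : Prop :=
  Continuous f ∧ f =ᵐ[volume] g

end Sobolev

/-- The energy `𝓔_N(t)`: the sum of the weighted norms of `h`, `A` and `Φ` over all products of at
most `N` fields of `𝔏`. -/
def energy (N : ℕ) (γ μ T : ℝ) (h : ℝ → L2 Tensor2) (A : ℝ → L2 GaugeForm) (Φ : ℝ → L2 Higgs)
    (t : ℝ) : ENNReal :=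
  ∑ k ∈ Finset.range (N + 1), ∑ I : Fin k → VF,
    (weightedNorm γ μ T h (List.ofFn I) t + weightedNorm γ μ T A (List.ofFn I) t +
      weightedNorm γ μ T Φ (List.ofFn I) t)

end EYMH

end

/-!
Up to a time `T` that is fixed, the estimates are estimates in the weight `1 + |x|` at each fixed
time: `w(q)` dominates `(1 + |x|)^(1 + 2γ)` up to a constant (`rpow_le_sqrt_weight`), a negative
power of `1 + |x|` is at most the same power of `1 + |q|` where `q > 0`, and `1 + |q|` is bounded
where `q < 0`.

The fields of `𝔏` control `(1 + |x|) ∂_β`, since `Ω_{0i} = t ∂_i + x_i ∂_t`, and the rotations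
together with the scaling give `|x| ∂_i`. As the commutators `[Z, ∂_β]` are combinations of
translations, the derivatives `∂^b ∂ Z^I u` with `|b| ≤ 3`, multiplied by `(1 + |x|)^|b|`, are
bounded pointwise by the `∂ Z^J Z^I u` with `|J| ≤ 3`, a purely algebraic fact about families of
derivatives (`GradBound.norm_deriv_le`). The energy therefore bounds
`(1 + |x|)^(1/2 + γ + |b|) ∂^b ∂ Z^I u` in `L²`.

With three derivatives there is an elementary Sobolev inequality on `ℝ³`. For a box with one corner
at `x` and with sides `ρ`, iterating `f(0) = ∫₀¹ (1 - (1 - a) d/da) f(a) da` in each variable gives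
`f(x) = ∫ ∏ᵢ (1 - ρᵢ (1 - pᵢ) ∂ᵢ) f (x + ρ p) dp` over the unit cube. Tested against smooth
functions this holds for weak derivatives (`ae_eq_integral_cubeSum`); the right-hand side is
continuous if the derivatives are in `L²`, and a cube of side `(1 + |x|) / 4`, on which the weight
is comparable to its value at `x`, gives the decay `(1 + |x|)^(-σ - 3/2)`
(`exists_contVersion_of_weighted`). With `σ = 1/2 + γ` this is the rate `-2 - γ` for `∂ Z^I u`.
Tangential derivatives are combinations of these with bounded coefficients, so that they decay at
the same rate.

For `|I| ≥ 1`, the function `Z^I u` is a combination of the `∂_γ Z^{I'} u`, `|I'| = |I| - 1`, with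
coefficients of size `1 + |x|`, whence the rate `-1 - γ`. The function `u` itself is in `L²`, and
the Sobolev inequality with `σ = -1/2` shows that it tends to zero at infinity, though not with a
constant given by the energy. Its values are recovered from the bound on `∂₁ u` by integration along
half lines parallel to the first axis (`norm_le_of_weakPartial_decay`); this is again
`ae_eq_integral_cubeSum`, now for a degenerate box of length tending to infinity.
-/

set_option linter.unusedSectionVars false

noncomputable section

namespace EYMH

open Set
open scoped Convolution

/-! ### Weak derivatives and translated test functions -/

section WeakDerivatives

variable {W : Type} [NormedAddCommGroup W] [NormedSpace ℝ W]

/-- `g` is the weak partial derivative `∂ᵢ f` on `ℝ³`, for functions rather than `L²` classes. It is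
meaningful for locally integrable `f` and `g`. -/
def HasWeakPartial (i : Fin 3) (f g : Space → W) : Prop :=
  ∀ φ : Space → ℝ, ContDiff ℝ ∞ φ → HasCompactSupport φ →
    ∫ x, (fderiv ℝ φ x (EuclideanSpace.single i 1)) • f x = -∫ x, φ x • g x

lemma HasWeakPartial.congr_ae {i : Fin 3} {f f' g g' : Space → W} (h : HasWeakPartial i f g)
    (hf : f =ᵐ[volume] f') (hg : g =ᵐ[volume] g') : HasWeakPartial i f' g' := by
  intro φ hφ hc
  have e1 : (fun x => (fderiv ℝ φ x (EuclideanSpace.single i 1)) • f x) =ᵐ[volume]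
      fun x => (fderiv ℝ φ x (EuclideanSpace.single i 1)) • f' x := by
    filter_upwards [hf] with x hx
    rw [hx]
  have e2 : (fun x => φ x • g x) =ᵐ[volume] fun x => φ x • g' x := by
    filter_upwards [hg] with x hx
    rw [hx]
  rw [← integral_congr_ae e1, ← integral_congr_ae e2]
  exact h φ hφ hc

/-- The pairing of `f` with the translate by `s` of a test function `φ`. -/
def testConv (φ : Space → ℝ) (f : Space → W) (s : Space) : W := ∫ y, φ (y - s) • f y

lemma testConv_eq_convolution (φ : Space → ℝ) (f : Space → W) :
    testConv φ f = f ⋆[(ContinuousLinearMap.lsmul ℝ ℝ).flip, volume] (fun z => φ (-z)) := by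
  funext s
  simp [testConv, convolution_def]

lemma testConv_eq_integral_translate (φ : Space → ℝ) (f : Space → W) (s : Space) :
    testConv φ f s = ∫ x, φ x • f (x + s) := by
  rw [testConv, ← integral_add_right_eq_self _ s]
  simp

lemma continuous_testConv {φ : Space → ℝ} (hφ : Continuous φ) (hc : HasCompactSupport φ)
    {f : Space → W} (hf : LocallyIntegrable f) : Continuous (testConv φ f) := by
  rw [testConv_eq_convolution]
  refine HasCompactSupport.continuous_convolution_right _ ?_ hf (hφ.comp continuous_neg)
  exact hc.comp_homeomorph (Homeomorph.neg Space)

/-- Translating a test function differentiates its pairing with `f` in the weak sense. -/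
lemma hasDerivAt_testConv {φ : Space → ℝ} (hφ : ContDiff ℝ ∞ φ) (hc : HasCompactSupport φ)
    {i : Fin 3} {f g : Space → W} (hf : LocallyIntegrable f) (h : HasWeakPartial i f g)
    (s : Space) (r a : ℝ) :
    HasDerivAt (fun a : ℝ => testConv φ f (s + (r * a) • EuclideanSpace.single i 1))
      (r • testConv φ g (s + (r * a) • EuclideanSpace.single i 1)) a := by
  set e : Space := EuclideanSpace.single i 1
  set ψ : Space → ℝ := fun z => φ (-z)
  have hψ : ContDiff ℝ ∞ ψ := hφ.comp contDiff_neg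
  have hψc : HasCompactSupport ψ := hc.comp_homeomorph (Homeomorph.neg Space)
  have key := (hψc.hasFDerivAt_convolution_right
    (ContinuousLinearMap.lsmul ℝ ℝ : ℝ →L[ℝ] W →L[ℝ] W).flip hf
    (hψ.of_le (by simp)) (s + (r * a) • e))
  have hline : HasDerivAt (fun a : ℝ => s + (r * a) • e) (r • e) a := by
    have := (((hasDerivAt_id a).const_mul r).smul_const e).const_add s
    simpa using this
  have h2 := key.comp_hasDerivAt a hline
  rw [testConv_eq_convolution]
  refine h2.congr_deriv ?_
  rw [map_smul, convolution_precompR_apply _ hf (hψc.fderiv (𝕜 := ℝ))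
    (hψ.continuous_fderiv (by simp))]
  congr 1
  -- both sides are the pairing with the translated test function
  set z := s + (r * a) • e
  have h3 := h (fun y => φ (y - z)) (hφ.comp (contDiff_id.sub contDiff_const))
    (hc.comp_homeomorph (Homeomorph.subRight z))
  rw [testConv, ← neg_eq_iff_eq_neg.2 h3, convolution_def, ← integral_neg]
  refine integral_congr_ae (.of_forall fun y => ?_)
  have h4 : fderiv ℝ ψ (z - y) e = -fderiv ℝ (fun y => φ (y - z)) y e := by
    have e1 : HasFDerivAt ψ ((fderiv ℝ φ (-(z - y))).comp (-ContinuousLinearMap.id ℝ Space))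
        (z - y) :=
      ((hφ.differentiable (by simp)) _).hasFDerivAt.comp _ (hasFDerivAt_id _).neg
    have e2 : HasFDerivAt (fun y => φ (y - z)) ((fderiv ℝ φ (y - z)).comp
        (ContinuousLinearMap.id ℝ Space)) y :=
      ((hφ.differentiable (by simp)) _).hasFDerivAt.comp _ ((hasFDerivAt_id _).sub_const _)
    rw [e1.fderiv, e2.fderiv]
    simp
  simp [h4, e]

end WeakDerivatives

/-! ### Averages over boxes -/

section Representation

variable {W : Type} [NormedAddCommGroup W] [NormedSpace ℝ W]

/-- The unit cube of parameters. -/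
def unitCube : Set (ℝ × ℝ × ℝ) := Icc 0 1 ×ˢ Icc 0 1 ×ˢ Icc 0 1

lemma isCompact_unitCube : IsCompact unitCube :=
  isCompact_Icc.prod (isCompact_Icc.prod isCompact_Icc)

lemma measurableSet_unitCube : MeasurableSet unitCube := isCompact_unitCube.measurableSet

/-- The displacement with components `ρᵢ pᵢ`. -/
def shift (ρ : Fin 3 → ℝ) (p : ℝ × ℝ × ℝ) : Space := !₂[ρ 0 * p.1, ρ 1 * p.2.1, ρ 2 * p.2.2]

lemma continuous_shift (ρ : Fin 3 → ℝ) : Continuous (shift ρ) := by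
  unfold shift
  fun_prop

/-- The family `f i j k`, which stands for `∂₁^i ∂₂^j ∂₃^k f` with `i, j, k ≤ 1`, combined to
`∏ᵢ (1 - ρᵢ (1 - pᵢ) ∂ᵢ) f`. -/
def cubeSum (ρ : Fin 3 → ℝ) (p : ℝ × ℝ × ℝ) (f : Fin 2 → Fin 2 → Fin 2 → W) : W :=
  ∑ i : Fin 2, ∑ j : Fin 2, ∑ k : Fin 2,
    ((-(ρ 0 * (1 - p.1))) ^ (i : ℕ) * (-(ρ 1 * (1 - p.2.1))) ^ (j : ℕ) *
      (-(ρ 2 * (1 - p.2.2))) ^ (k : ℕ)) • f i j k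

/-- The fundamental theorem of calculus for `(1 - a) g(a)`. -/
lemma integral_unitInterval_deriv [CompleteSpace W] {r : ℝ} {g g' : ℝ → W}
    (h : ∀ a, HasDerivAt g (r • g' a) a)
    (hc : Continuous g') : ∫ a in Icc (0 : ℝ) 1, (g a + (-(r * (1 - a))) • g' a) = g 0 := by
  have hg : Continuous g := continuous_iff_continuousAt.2 fun a => (h a).continuousAt
  rw [integral_Icc_eq_integral_Ioc, ← intervalIntegral.integral_of_le zero_le_one]
  have hd : ∀ a ∈ uIcc (0 : ℝ) 1, HasDerivAt (fun a => (a - 1) • g a)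
      (g a + (-(r * (1 - a))) • g' a) a := by
    intro a _
    have := ((hasDerivAt_id a).sub_const 1).smul (h a)
    refine this.congr_deriv ?_
    simp only [id, one_smul, smul_smul]
    rw [add_comm]
    congr 2
    ring
  rw [intervalIntegral.integral_eq_sub_of_hasDerivAt hd
    (Continuous.intervalIntegrable (by fun_prop) _ _)]
  simp

/-- The mixed fundamental theorem of calculus on the unit cube. -/
lemma integral_cubeSum [CompleteSpace W] (ρ : Fin 3 → ℝ) (G : Fin 2 → Fin 2 → Fin 2 → ℝ × ℝ × ℝ → W)
    (hG : ∀ i j k, Continuous (G i j k))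
    (h0 : ∀ j k a b c, HasDerivAt (fun a => G 0 j k (a, b, c)) (ρ 0 • G 1 j k (a, b, c)) a)
    (h1 : ∀ i k a b c, HasDerivAt (fun b => G i 0 k (a, b, c)) (ρ 1 • G i 1 k (a, b, c)) b)
    (h2 : ∀ i j a b c, HasDerivAt (fun c => G i j 0 (a, b, c)) (ρ 2 • G i j 1 (a, b, c)) c) :
    ∫ p in unitCube, cubeSum ρ p (fun i j k => G i j k p) = G 0 0 0 0 := by
  have hcont : Continuous fun p => cubeSum ρ p (fun i j k => G i j k p) := by
    unfold cubeSum
    fun_prop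
  have e3 : ∀ a b i j, ∫ c in Icc (0 : ℝ) 1,
      (G i j 0 (a, b, c) + (-(ρ 2 * (1 - c))) • G i j 1 (a, b, c)) = G i j 0 (a, b, 0) :=
    fun a b i j => integral_unitInterval_deriv (fun c => h2 i j a b c)
      ((hG i j 1).comp (by fun_prop))
  have e2 : ∀ a i, ∫ b in Icc (0 : ℝ) 1,
      (G i 0 0 (a, b, 0) + (-(ρ 1 * (1 - b))) • G i 1 0 (a, b, 0)) = G i 0 0 (a, 0, 0) :=
    fun a i => integral_unitInterval_deriv (fun b => h1 i 0 a b 0)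
      ((hG i 1 0).comp (by fun_prop))
  have e1 : ∫ a in Icc (0 : ℝ) 1,
      (G 0 0 0 (a, 0, 0) + (-(ρ 0 * (1 - a))) • G 1 0 0 (a, 0, 0)) = G 0 0 0 (0, 0, 0) :=
    integral_unitInterval_deriv (fun a => h0 0 0 a 0 0) ((hG 1 0 0).comp (by fun_prop))
  have hi : ∀ g : ℝ → W, Continuous g → Integrable g (volume.restrict (Icc (0 : ℝ) 1)) :=
    fun g hg => hg.continuousOn.integrableOn_compact isCompact_Icc
  have hint := hcont.continuousOn.integrableOn_compact (μ := volume) isCompact_unitCube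
  unfold unitCube at hint ⊢
  rw [Measure.volume_eq_prod, setIntegral_prod _ hint, show (0 : ℝ × ℝ × ℝ) = (0, 0, 0) from rfl,
    ← e1]
  refine integral_congr_ae (.of_forall fun a => ?_)
  have hint2 : IntegrableOn (fun q : ℝ × ℝ => cubeSum ρ (a, q) (fun i j k => G i j k (a, q)))
      (Icc 0 1 ×ˢ Icc 0 1) :=
    (hcont.comp (by fun_prop)).continuousOn.integrableOn_compact (isCompact_Icc.prod isCompact_Icc)
  simp only
  rw [Measure.volume_eq_prod, setIntegral_prod _ hint2, ← e2, ← e2, ← integral_smul,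
    ← integral_add (hi _ (by fun_prop)) (hi _ (by fun_prop))]
  refine integral_congr_ae (.of_forall fun b => ?_)
  simp only
  rw [← e3, ← e3, ← e3, ← e3]
  simp only [← integral_smul]
  rw [← integral_add (hi _ (by fun_prop)) (hi _ (by fun_prop)),
    ← integral_add (hi _ (by fun_prop)) (hi _ (by fun_prop)), ← integral_smul,
    ← integral_add (hi _ (by fun_prop)) (hi _ (by fun_prop))]
  refine integral_congr_ae (.of_forall fun c => ?_)
  simp only [cubeSum, Fin.sum_univ_two, Fin.coe_ofNat_eq_mod, Nat.zero_mod, Nat.one_mod, pow_zero,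
    pow_one]
  module

lemma shift_fst (ρ : Fin 3 → ℝ) (a b c : ℝ) :
    shift ρ (a, b, c) = shift ρ (0, b, c) + (ρ 0 * a) • EuclideanSpace.single 0 1 := by
  ext i
  fin_cases i <;> simp [shift]

lemma shift_snd (ρ : Fin 3 → ℝ) (a b c : ℝ) :
    shift ρ (a, b, c) = shift ρ (a, 0, c) + (ρ 1 * b) • EuclideanSpace.single 1 1 := by
  ext i
  fin_cases i <;> simp [shift]

lemma shift_trd (ρ : Fin 3 → ℝ) (a b c : ℝ) :
    shift ρ (a, b, c) = shift ρ (a, b, 0) + (ρ 2 * c) • EuclideanSpace.single 2 1 := by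
  ext i
  fin_cases i <;> simp [shift]

lemma hasDerivAt_testConv_of_ne_zero {φ : Space → ℝ} (hφ : ContDiff ℝ ∞ φ)
    (hc : HasCompactSupport φ) {i : Fin 3} {f g : Space → W} (hf : LocallyIntegrable f) {r : ℝ}
    (h : r ≠ 0 → HasWeakPartial i f g) (s : Space) (a : ℝ) :
    HasDerivAt (fun a : ℝ => testConv φ f (s + (r * a) • EuclideanSpace.single i 1))
      (r • testConv φ g (s + (r * a) • EuclideanSpace.single i 1)) a := by
  by_cases hr : r = 0
  · subst hr
    simpa using hasDerivAt_const a (testConv φ f s)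
  · exact hasDerivAt_testConv hφ hc hf (h hr) s r a

lemma integrable_test_mul_translate {φ : Space → ℝ} (hφ : Continuous φ) (hc : HasCompactSupport φ)
    {f : Space → W} (hf : LocallyIntegrable f) (hm : StronglyMeasurable f) (ρ : Fin 3 → ℝ)
    {c : ℝ × ℝ × ℝ → ℝ} (hcc : Continuous c) :
    Integrable (fun z : Space × (ℝ × ℝ × ℝ) => φ z.1 • c z.2 • f (z.1 + shift ρ z.2))
      ((volume : Measure Space).prod (volume.restrict unitCube)) := by
  have hmeas : StronglyMeasurable
      (fun z : Space × (ℝ × ℝ × ℝ) => φ z.1 • c z.2 • f (z.1 + shift ρ z.2)) := by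
    refine (hφ.comp continuous_fst).stronglyMeasurable.smul
      ((hcc.comp continuous_snd).stronglyMeasurable.smul ?_)
    exact hm.comp_measurable
      (continuous_fst.add ((continuous_shift ρ).comp continuous_snd)).measurable
  rw [integrable_prod_iff' hmeas.aestronglyMeasurable]
  have htr : ∀ p, LocallyIntegrable (fun x => f (x + shift ρ p)) := fun p => by
    intro x
    obtain ⟨U, hU, hfU⟩ := hf (x + shift ρ p)
    have hmp : MeasurePreserving (fun y : Space => y + shift ρ p) volume volume :=
      measurePreserving_add_right _ _
    refine ⟨(fun y => y + shift ρ p) ⁻¹' U,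
      (continuous_add_const (shift ρ p)).continuousAt.preimage_mem_nhds hU, ?_⟩
    exact (hmp.integrableOn_comp_preimage
      (Homeomorph.addRight (shift ρ p)).measurableEmbedding).2 hfU
  refine ⟨.of_forall fun p => ?_, ?_⟩
  · simp only
    exact ((htr p).smul (c p)).integrable_smul_left_of_hasCompactSupport hφ hc
  · have e : ∀ p, ∫ x, ‖φ x • c p • f (x + shift ρ p)‖
        = |c p| * testConv (fun x => |φ x|) (fun x => ‖f x‖) (shift ρ p) := by
      intro p
      rw [testConv_eq_integral_translate, ← integral_const_mul]
      refine integral_congr_ae (.of_forall fun x => ?_)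
      simp only [norm_smul, Real.norm_eq_abs, smul_eq_mul]
      ring
    simp only [e]
    refine ContinuousOn.integrableOn_compact isCompact_unitCube (Continuous.continuousOn ?_)
    exact hcc.abs.mul ((continuous_testConv hφ.abs (hc.comp_left (g := fun x => |x|) abs_zero)
      (fun x => (hf x).imp fun U hU => ⟨hU.1, hU.2.norm⟩)).comp (continuous_shift ρ))

/-- A function with weak derivatives `f i j k = ∂₁^i ∂₂^j ∂₃^k f` is almost everywhere an average of
these derivatives over a box of sides `ρ` at the point. No derivative is needed in a direction in
which the box is degenerate. -/
theorem ae_eq_integral_cubeSum [CompleteSpace W] (ρ : Fin 3 → ℝ)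
    (f : Fin 2 → Fin 2 → Fin 2 → Space → W)
    (hm : ∀ i j k, StronglyMeasurable (f i j k)) (hf : ∀ i j k, LocallyIntegrable (f i j k))
    (h0 : ρ 0 ≠ 0 → ∀ j k, HasWeakPartial 0 (f 0 j k) (f 1 j k))
    (h1 : ρ 1 ≠ 0 → ∀ i k, HasWeakPartial 1 (f i 0 k) (f i 1 k))
    (h2 : ρ 2 ≠ 0 → ∀ i j, HasWeakPartial 2 (f i j 0) (f i j 1))
    (hF : Continuous fun x => ∫ p in unitCube, cubeSum ρ p (fun i j k => f i j k (x + shift ρ p))) :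
    f 0 0 0 =ᵐ[volume]
      fun x => ∫ p in unitCube, cubeSum ρ p (fun i j k => f i j k (x + shift ρ p)) := by
  refine ae_eq_of_integral_contDiff_smul_eq (hf 0 0 0) hF.locallyIntegrable fun φ hφ hc => ?_
  have hint : ∀ i j k : Fin 2, Integrable (fun z : Space × (ℝ × ℝ × ℝ) => φ z.1 •
      ((-(ρ 0 * (1 - z.2.1))) ^ (i : ℕ) * (-(ρ 1 * (1 - z.2.2.1))) ^ (j : ℕ) *
        (-(ρ 2 * (1 - z.2.2.2))) ^ (k : ℕ)) • f i j k (z.1 + shift ρ z.2))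
      ((volume : Measure Space).prod (volume.restrict unitCube)) := fun i j k =>
    integrable_test_mul_translate hφ.continuous hc (hf i j k) (hm i j k) ρ
      (c := fun p => (-(ρ 0 * (1 - p.1))) ^ (i : ℕ) * (-(ρ 1 * (1 - p.2.1))) ^ (j : ℕ) *
        (-(ρ 2 * (1 - p.2.2))) ^ (k : ℕ)) (by fun_prop)
  have hG := integral_cubeSum ρ (fun i j k p => testConv φ (f i j k) (shift ρ p))
    (fun i j k => (continuous_testConv hφ.continuous hc (hf i j k)).comp (continuous_shift ρ))
    (fun j k a b c => by
      have := hasDerivAt_testConv_of_ne_zero hφ hc (hf 0 j k) (fun h => h0 h j k)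
        (shift ρ (0, b, c)) a
      simp only [← shift_fst] at this
      exact this)
    (fun i k a b c => by
      have := hasDerivAt_testConv_of_ne_zero hφ hc (hf i 0 k) (fun h => h1 h i k)
        (shift ρ (a, 0, c)) b
      simp only [← shift_snd] at this
      exact this)
    (fun i j a b c => by
      have := hasDerivAt_testConv_of_ne_zero hφ hc (hf i j 0) (fun h => h2 h i j)
        (shift ρ (a, b, 0)) c
      simp only [← shift_trd] at this
      exact this)
  have hz : shift ρ 0 = 0 := by
    ext i
    fin_cases i <;> simp [shift]
  have hsum : Integrable (fun z : Space × (ℝ × ℝ × ℝ) => φ z.1 •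
      cubeSum ρ z.2 (fun i j k => f i j k (z.1 + shift ρ z.2)))
      ((volume : Measure Space).prod (volume.restrict unitCube)) := by
    simp only [cubeSum, Finset.smul_sum]
    exact integrable_finsetSum _ fun i _ => integrable_finsetSum _ fun j _ =>
      integrable_finsetSum _ fun k _ => hint i j k
  calc ∫ x, φ x • f 0 0 0 x = testConv φ (f 0 0 0) (shift ρ 0) := by
        rw [hz, testConv_eq_integral_translate]
        simp
    _ = ∫ p in unitCube, ∫ x, φ x • cubeSum ρ p (fun i j k => f i j k (x + shift ρ p)) := by
        rw [← hG]
        refine integral_congr_ae ?_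
        have hae : ∀ᵐ p ∂(volume.restrict unitCube), ∀ i j k : Fin 2, Integrable (fun x => φ x •
            ((-(ρ 0 * (1 - p.1))) ^ (i : ℕ) * (-(ρ 1 * (1 - p.2.1))) ^ (j : ℕ) *
              (-(ρ 2 * (1 - p.2.2))) ^ (k : ℕ)) • f i j k (x + shift ρ p)) := by
          simp only [ae_all_iff]
          exact fun i j k => (hint i j k).prod_left_ae
        filter_upwards [hae] with p hp
        simp only [cubeSum, Finset.smul_sum]
        rw [integral_finsetSum _ fun i _ => integrable_finsetSum _ fun j _ =>
          integrable_finsetSum _ fun k _ => hp i j k]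
        refine Finset.sum_congr rfl fun i _ => ?_
        rw [integral_finsetSum _ fun j _ => integrable_finsetSum _ fun k _ => hp i j k]
        refine Finset.sum_congr rfl fun j _ => ?_
        rw [integral_finsetSum _ fun k _ => hp i j k]
        refine Finset.sum_congr rfl fun k _ => ?_
        rw [testConv_eq_integral_translate, ← integral_smul]
        refine integral_congr_ae (.of_forall fun x => ?_)
        exact smul_comm _ _ _
    _ = ∫ x, ∫ p in unitCube, φ x • cubeSum ρ p (fun i j k => f i j k (x + shift ρ p)) :=
        (integral_integral_swap hsum).symm
    _ = ∫ x, φ x • ∫ p in unitCube, cubeSum ρ p (fun i j k => f i j k (x + shift ρ p)) := by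
        simp only [integral_smul]

end Representation

/-! ### `L²` functions on cubes -/

section CubeAverages

variable {W : Type} [NormedAddCommGroup W] [NormedSpace ℝ W]

lemma measurePreserving_shift_one :
    MeasurePreserving (shift fun _ => 1) (volume : Measure (ℝ × ℝ × ℝ)) volume := by
  have h1 := volume_preserving_piFinSuccAbove (fun _ : Fin 3 => ℝ) 0
  have h2 : MeasurePreserving (Prod.map id MeasurableEquiv.finTwoArrow)
      (volume : Measure (ℝ × (Fin 2 → ℝ))) (volume : Measure (ℝ × ℝ × ℝ)) :=
    (MeasurePreserving.id _).prod (volume_preserving_finTwoArrow ℝ)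
  have h3 : MeasurePreserving ((MeasurableEquiv.piFinSuccAbove (fun _ : Fin 3 => ℝ) 0).trans
      ((MeasurableEquiv.refl ℝ).prodCongr MeasurableEquiv.finTwoArrow)) volume volume :=
    h2.comp h1
  have h4 := (PiLp.volume_preserving_toLp (Fin 3)).comp h3.symm
  have e : (shift fun _ => 1) = (WithLp.toLp 2 : (Fin 3 → ℝ) → Space) ∘
      ⇑((MeasurableEquiv.piFinSuccAbove (fun _ : Fin 3 => ℝ) 0).trans
        ((MeasurableEquiv.refl ℝ).prodCongr MeasurableEquiv.finTwoArrow)).symm := by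
    funext p
    ext i
    fin_cases i <;> simp [shift] <;> rfl
  rw [e]
  exact h4

lemma shift_const (ρ : ℝ) (p : ℝ × ℝ × ℝ) : shift (fun _ => ρ) p = ρ • shift (fun _ => 1) p := by
  ext i
  fin_cases i <;> simp [shift]

lemma map_add_shift {ρ : ℝ} (hρ : 0 < ρ) (x : Space) :
    Measure.map (fun p => x + shift (fun _ => ρ) p) (volume : Measure (ℝ × ℝ × ℝ))
      = ENNReal.ofReal (ρ ^ 3)⁻¹ • (volume : Measure Space) := by
  have e : (fun p => x + shift (fun _ => ρ) p)
      = (fun y => x + y) ∘ (fun y : Space => ρ • y) ∘ shift (fun _ => 1) := by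
    funext p
    simp [shift_const ρ p]
  rw [e, ← Measure.map_map (measurable_const_add x)
    ((measurable_const_smul ρ).comp measurePreserving_shift_one.measurable),
    ← Measure.map_map (measurable_const_smul ρ) measurePreserving_shift_one.measurable,
    measurePreserving_shift_one.map_eq, Measure.map_addHaar_smul _ hρ.ne', Measure.map_smul,
    map_add_left_eq_self]
  simp [abs_of_pos hρ]

instance : IsProbabilityMeasure ((volume : Measure (ℝ × ℝ × ℝ)).restrict unitCube) := by
  refine ⟨?_⟩
  rw [Measure.restrict_apply_univ, unitCube, Measure.volume_eq_prod, Measure.prod_prod,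
    Measure.volume_eq_prod, Measure.prod_prod]
  simp

/-- The `L¹` norm over a cube of side `ρ`, in normalized coordinates, is controlled by the `L²` norm
on `ℝ³`. -/
lemma eLpNorm_translate_cube_le {ρ : ℝ} (hρ : 0 < ρ) {V : Type} [NormedAddCommGroup V]
    (x : Space) {h : Space → V}
    (hm : StronglyMeasurable h) :
    eLpNorm (fun p => h (x + shift (fun _ => ρ) p)) 1 (volume.restrict unitCube)
      ≤ ENNReal.ofReal (ρ ^ (-(3 / 2) : ℝ)) * eLpNorm h 2 volume := by
  have hmeas : Measurable (fun p => x + shift (fun _ => ρ) p) :=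
    (continuous_const.add (continuous_shift _)).measurable
  calc eLpNorm (fun p => h (x + shift (fun _ => ρ) p)) 1 (volume.restrict unitCube)
      ≤ eLpNorm (fun p => h (x + shift (fun _ => ρ) p)) 2 (volume.restrict unitCube) :=
        eLpNorm_le_eLpNorm_of_exponent_le (by norm_num)
          (hm.comp_measurable hmeas).aestronglyMeasurable
    _ ≤ eLpNorm (fun p => h (x + shift (fun _ => ρ) p)) 2 volume :=
        eLpNorm_mono_measure _ Measure.restrict_le_self
    _ = eLpNorm h 2 (Measure.map (fun p => x + shift (fun _ => ρ) p) volume) :=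
        (eLpNorm_map_measure hm.aestronglyMeasurable hmeas.aemeasurable).symm
    _ = ENNReal.ofReal (ρ ^ (-(3 / 2) : ℝ)) * eLpNorm h 2 volume := by
        rw [map_add_shift hρ, eLpNorm_smul_measure_of_ne_top (by simp), smul_eq_mul,
          ENNReal.ofReal_rpow_of_nonneg (by positivity) (by positivity)]
        congr 2
        rw [← Real.rpow_natCast, ← Real.rpow_neg hρ.le, ← Real.rpow_mul hρ.le]
        norm_num

lemma integrable_translate_cube {ρ : ℝ} (hρ : 0 < ρ) (x : Space) {h : Space → W}
    (hm : StronglyMeasurable h) (h2 : MemLp h 2 volume) :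
    IntegrableOn (fun p => h (x + shift (fun _ => ρ) p)) unitCube := by
  have hmeas : Measurable (fun p => x + shift (fun _ => ρ) p) :=
    (continuous_const.add (continuous_shift _)).measurable
  refine memLp_one_iff_integrable.1 ⟨(hm.comp_measurable hmeas).aestronglyMeasurable, ?_⟩
  exact (eLpNorm_translate_cube_le hρ x hm).trans_lt
    (ENNReal.mul_lt_top ENNReal.ofReal_lt_top h2.2)

/-- Averages over cubes of an `L²` function, with a continuous density, are continuous. -/
lemma continuous_integral_translate_cube {ρ : ℝ} (hρ : 0 < ρ) {c : ℝ × ℝ × ℝ → ℝ}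
    (hc : Continuous c) {f : Space → W} (hm : StronglyMeasurable f) (hf : MemLp f 2 volume) :
    Continuous fun x => ∫ p in unitCube, c p • f (x + shift (fun _ => ρ) p) := by
  obtain ⟨B, hB⟩ := isCompact_unitCube.exists_bound_of_continuousOn hc.continuousOn
  have hB0 : 0 ≤ B := (norm_nonneg _).trans (hB (0, 0, 0) (by simp [unitCube]))
  refine continuous_of_uniform_approx_of_continuous fun u hu => ?_
  obtain ⟨η, hη, hηu⟩ := Metric.mem_uniformity_dist.1 hu
  set k : ℝ := ρ ^ (-(3 / 2) : ℝ)
  have hk : 0 < k := Real.rpow_pos_of_pos hρ _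
  set δ : ℝ := η / (2 * (B + 1) * k)
  have hδ : 0 < δ := by positivity
  obtain ⟨g, -, hfg, hg, hg2⟩ := hf.exists_hasCompactSupport_eLpNorm_sub_le (by simp)
    (ε := ENNReal.ofReal δ) (by simpa using hδ)
  refine ⟨fun x => ∫ p in unitCube, c p • g (x + shift (fun _ => ρ) p), ?_, fun x => hηu ?_⟩
  · refine continuous_parametric_integral_of_continuous ?_ isCompact_unitCube
    have := continuous_shift (fun _ => ρ)
    unfold Function.uncurry
    fun_prop
  have hfgm : StronglyMeasurable (f - g) := hm.sub hg.stronglyMeasurable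
  have hint : IntegrableOn (fun p => (f - g) (x + shift (fun _ => ρ) p)) unitCube :=
    integrable_translate_cube hρ x hfgm (hf.sub hg2)
  have hbd : ∀ {h : Space → W}, IntegrableOn (fun p => h (x + shift (fun _ => ρ) p)) unitCube →
      IntegrableOn (fun p => c p • h (x + shift (fun _ => ρ) p)) unitCube := fun {h} hh =>
    hh.bdd_smul B hc.aestronglyMeasurable
      ((ae_restrict_iff' measurableSet_unitCube).2 (.of_forall fun p hp => hB p hp))
  rw [dist_eq_norm, ← integral_sub (hbd (integrable_translate_cube hρ x hm hf))
    (hbd (integrable_translate_cube hρ x hg.stronglyMeasurable hg2))]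
  have hle : ∫ p in unitCube, ‖(f - g) (x + shift (fun _ => ρ) p)‖ ≤ k * δ := by
    have h1 := (eLpNorm_translate_cube_le hρ x hfgm).trans (mul_le_mul_right hfg _)
    rw [eLpNorm_one_eq_lintegral_enorm, ← ofReal_integral_norm_eq_lintegral_enorm hint,
      ← ENNReal.ofReal_mul hk.le] at h1
    exact (ENNReal.ofReal_le_ofReal_iff (by positivity)).1 h1
  calc ‖∫ p in unitCube, (c p • f (x + shift (fun _ => ρ) p) - c p • g (x + shift (fun _ => ρ) p))‖
      ≤ ∫ p in unitCube, B * ‖(f - g) (x + shift (fun _ => ρ) p)‖ := by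
        refine norm_integral_le_of_norm_le (hint.norm.const_mul B)
          ((ae_restrict_iff' measurableSet_unitCube).2 (.of_forall fun p hp => ?_))
        rw [← smul_sub, norm_smul]
        exact mul_le_mul_of_nonneg_right (hB p hp) (norm_nonneg _)
    _ ≤ B * (k * δ) := by
        rw [integral_const_mul]
        exact mul_le_mul_of_nonneg_left hle hB0
    _ < η := by
        have : (B + 1) * (k * δ) = η / 2 := by
          simp only [δ]
          field_simp
        nlinarith [mul_pos hk hδ]

end CubeAverages

/-! ### A weighted Sobolev inequality -/

section Sobolev

variable {W : Type} [NormedAddCommGroup W] [NormedSpace ℝ W]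

lemma norm_shift_one_le {p : ℝ × ℝ × ℝ} (hp : p ∈ unitCube) : ‖shift (fun _ => 1) p‖ ≤ 2 := by
  obtain ⟨⟨h1, h2⟩, ⟨h3, h4⟩, h5, h6⟩ := hp
  rw [EuclideanSpace.norm_eq, Real.sqrt_le_left (by norm_num)]
  simp only [shift, Fin.sum_univ_three, Real.norm_eq_abs, sq_abs]
  simp
  nlinarith

lemma norm_cubeSum_le {ρ : ℝ} (hρ : 0 ≤ ρ) {p : ℝ × ℝ × ℝ} (hp : p ∈ unitCube)
    (f : Fin 2 → Fin 2 → Fin 2 → W) {M : ℝ}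
    (hM : ∀ i j k : Fin 2, ρ ^ ((i : ℕ) + j + k) * ‖f i j k‖ ≤ M) :
    ‖cubeSum (fun _ => ρ) p f‖ ≤ 8 * M := by
  have hc : ∀ a : ℝ, a ∈ Icc (0 : ℝ) 1 → ∀ i : ℕ, |(-(ρ * (1 - a))) ^ i| ≤ ρ ^ i := by
    intro a ha i
    rw [abs_pow, abs_neg, abs_of_nonneg (mul_nonneg hρ (sub_nonneg.2 ha.2))]
    exact pow_le_pow_left₀ (mul_nonneg hρ (sub_nonneg.2 ha.2))
      (mul_le_of_le_one_right hρ (by linarith [ha.1])) i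
  have hterm : ∀ i j k : Fin 2, ‖((-(ρ * (1 - p.1))) ^ (i : ℕ) * (-(ρ * (1 - p.2.1))) ^ (j : ℕ) *
      (-(ρ * (1 - p.2.2))) ^ (k : ℕ)) • f i j k‖ ≤ M := by
    intro i j k
    refine le_trans ?_ (hM i j k)
    rw [norm_smul, Real.norm_eq_abs, abs_mul, abs_mul, pow_add, pow_add]
    have := hc _ hp.1 i
    have := hc _ hp.2.1 j
    have := hc _ hp.2.2 k
    gcongr
  calc ‖cubeSum (fun _ => ρ) p f‖ ≤ ∑ i : Fin 2, ∑ j : Fin 2, ∑ k : Fin 2, M :=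
        norm_sum_le_of_le _ fun i _ => norm_sum_le_of_le _ fun j _ => norm_sum_le_of_le _ fun k _ =>
          hterm i j k
    _ = 8 * M := by
        simp
        ring

/-- The weighted Sobolev inequality on `ℝ³`: a function whose mixed weak derivatives
`∂₁^i ∂₂^j ∂₃^k f` with `i, j, k ≤ 1`, multiplied by `(1 + |x|)^(σ + i + j + k)`, are dominated by
a function of `L²` has a continuous version which decays like `(1 + |x|)^(-σ - 3/2)`. It follows
from the averages over a cube at `x` of side comparable to `1 + |x|`. -/
theorem exists_contVersion_of_weighted [CompleteSpace W] {σ A : ℝ} (hA : 0 ≤ A)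
    (f : Fin 2 → Fin 2 → Fin 2 → Space → W) (hm : ∀ i j k, StronglyMeasurable (f i j k))
    (hf : ∀ i j k, MemLp (f i j k) 2 volume)
    (h0 : ∀ j k, HasWeakPartial 0 (f 0 j k) (f 1 j k))
    (h1 : ∀ i k, HasWeakPartial 1 (f i 0 k) (f i 1 k))
    (h2 : ∀ i j, HasWeakPartial 2 (f i j 0) (f i j 1))
    (m : Space → ℝ) (hmm : StronglyMeasurable m) (hmA : eLpNorm m 2 volume ≤ ENNReal.ofReal A)
    (hfm : ∀ (i j k : Fin 2) x, (1 + ‖x‖) ^ (((i : ℕ) + j + k : ℕ) + σ) * ‖f i j k x‖ ≤ m x) :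
    ∃ F : Space → W, IsContVersion F (f 0 0 0) ∧
      ∀ x, ‖F x‖ ≤ 64 * 2 ^ |σ| * A * (1 + ‖x‖) ^ (-σ - 3 / 2) := by
  set F : ℝ → Space → W := fun ρ x =>
    ∫ p in unitCube, cubeSum (fun _ => ρ) p (fun i j k => f i j k (x + shift (fun _ => ρ) p))
  have hterm : ∀ ρ, 0 < ρ → ∀ x, ∀ i j k : Fin 2, IntegrableOn (fun p =>
      ((-(ρ * (1 - p.1))) ^ (i : ℕ) * (-(ρ * (1 - p.2.1))) ^ (j : ℕ) *
        (-(ρ * (1 - p.2.2))) ^ (k : ℕ)) • f i j k (x + shift (fun _ => ρ) p)) unitCube := by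
    intro ρ hρ x i j k
    have hc : Continuous fun p : ℝ × ℝ × ℝ => (-(ρ * (1 - p.1))) ^ (i : ℕ) *
      (-(ρ * (1 - p.2.1))) ^ (j : ℕ) * (-(ρ * (1 - p.2.2))) ^ (k : ℕ) := by fun_prop
    obtain ⟨B, hB⟩ := isCompact_unitCube.exists_bound_of_continuousOn hc.continuousOn
    exact (integrable_translate_cube hρ x (hm i j k) (hf i j k)).bdd_smul B hc.aestronglyMeasurable
      ((ae_restrict_iff' measurableSet_unitCube).2 (.of_forall fun p hp => hB p hp))
  have hFc : ∀ ρ, 0 < ρ → Continuous (F ρ) := by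
    intro ρ hρ
    have e : F ρ = fun x => ∑ i : Fin 2, ∑ j : Fin 2, ∑ k : Fin 2, ∫ p in unitCube,
        ((-(ρ * (1 - p.1))) ^ (i : ℕ) * (-(ρ * (1 - p.2.1))) ^ (j : ℕ) *
          (-(ρ * (1 - p.2.2))) ^ (k : ℕ)) • f i j k (x + shift (fun _ => ρ) p) := by
      funext x
      simp only [F, cubeSum]
      rw [integral_finsetSum _ fun i _ => integrable_finsetSum _ fun j _ =>
        integrable_finsetSum _ fun k _ => hterm ρ hρ x i j k]
      refine Finset.sum_congr rfl fun i _ => ?_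
      rw [integral_finsetSum _ fun j _ => integrable_finsetSum _ fun k _ => hterm ρ hρ x i j k]
      refine Finset.sum_congr rfl fun j _ => ?_
      rw [integral_finsetSum _ fun k _ => hterm ρ hρ x i j k]
    rw [e]
    exact continuous_finsetSum _ fun i _ => continuous_finsetSum _ fun j _ =>
      continuous_finsetSum _ fun k _ =>
        continuous_integral_translate_cube hρ (by fun_prop) (hm i j k) (hf i j k)
  have hFae : ∀ ρ, 0 < ρ → f 0 0 0 =ᵐ[volume] F ρ := fun ρ hρ =>
    ae_eq_integral_cubeSum (fun _ => ρ) f hm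
      (fun i j k => (hf i j k).locallyIntegrable (by norm_num))
      (fun _ => h0) (fun _ => h1) (fun _ => h2) (hFc ρ hρ)
  have hF1 : ∀ ρ, 0 < ρ → F ρ = F 1 := fun ρ hρ =>
    ((hFc ρ hρ).ae_eq_iff_eq volume (hFc 1 one_pos)).1
      ((hFae ρ hρ).symm.trans (hFae 1 one_pos))
  refine ⟨F 1, ⟨hFc 1 one_pos, (hFae 1 one_pos).symm⟩, fun x => ?_⟩
  set R : ℝ := 1 + ‖x‖
  have hR : 1 ≤ R := by simp [R]
  have hR0 : 0 < R := by linarith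
  have hρ : 0 < R / 4 := by positivity
  rw [← hF1 _ hρ]
  have hmL : MemLp m 2 volume :=
    ⟨hmm.aestronglyMeasurable, hmA.trans_lt ENNReal.ofReal_lt_top⟩
  have hint := integrable_translate_cube hρ x hmm hmL
  have hmle : ∫ p in unitCube, m (x + shift (fun _ => R / 4) p)
      ≤ (R / 4) ^ (-(3 / 2) : ℝ) * A := by
    have h1 := (eLpNorm_translate_cube_le hρ x hmm).trans (mul_le_mul_right hmA _)
    rw [eLpNorm_one_eq_lintegral_enorm, ← ofReal_integral_norm_eq_lintegral_enorm hint,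
      ← ENNReal.ofReal_mul (by positivity)] at h1
    refine le_trans (integral_mono hint hint.norm fun p => le_abs_self _) ?_
    exact (ENNReal.ofReal_le_ofReal_iff (by positivity)).1 h1
  have hpt : ∀ p ∈ unitCube, ‖cubeSum (fun _ => R / 4) p
      (fun i j k => f i j k (x + shift (fun _ => R / 4) p))‖
        ≤ 8 * (2 ^ |σ| * R ^ (-σ) * m (x + shift (fun _ => R / 4) p)) := by
    intro p hp
    refine norm_cubeSum_le hρ.le hp _ fun i j k => ?_
    set y := x + shift (fun _ => R / 4) p
    -- on the cube `1 + |y|` is comparable to `1 + |x|`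
    have hyx : ‖y - x‖ ≤ R / 2 := by
      simp only [y, add_sub_cancel_left]
      rw [shift_const, norm_smul, Real.norm_eq_abs, abs_of_pos hρ]
      nlinarith [norm_shift_one_le hp]
    have hy1 : R / 2 ≤ 1 + ‖y‖ := by
      have := norm_sub_norm_le x y
      rw [norm_sub_rev] at this
      simp only [R] at *
      linarith
    have hy2 : 1 + ‖y‖ ≤ 2 * R := by
      have := norm_sub_norm_le y x
      simp only [R] at *
      linarith
    have hy0 : 0 < 1 + ‖y‖ := by positivity
    have hσ : (1 + ‖y‖) ^ (-σ) ≤ 2 ^ |σ| * R ^ (-σ) := by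
      rcases le_total 0 σ with hs | hs
      · rw [abs_of_nonneg hs]
        calc (1 + ‖y‖) ^ (-σ) ≤ (R / 2) ^ (-σ) :=
              Real.rpow_le_rpow_of_nonpos (by positivity) hy1 (by linarith)
          _ = 2 ^ σ * R ^ (-σ) := by
              rw [Real.div_rpow hR0.le (by norm_num), Real.rpow_neg (by norm_num : (0 : ℝ) ≤ 2)]
              field_simp
      · rw [abs_of_nonpos hs]
        calc (1 + ‖y‖) ^ (-σ) ≤ (2 * R) ^ (-σ) :=
              Real.rpow_le_rpow hy0.le hy2 (by linarith)
          _ = 2 ^ (-σ) * R ^ (-σ) := Real.mul_rpow (by norm_num) hR0.le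
    have hmy : 0 ≤ m y := le_trans (by positivity) (hfm i j k y)
    calc (R / 4) ^ ((i : ℕ) + j + k) * ‖f i j k y‖
        ≤ (1 + ‖y‖) ^ ((i : ℕ) + j + k) * ‖f i j k y‖ := by
          gcongr
          linarith
      _ = (1 + ‖y‖) ^ (-σ) * ((1 + ‖y‖) ^ (((i : ℕ) + j + k : ℕ) + σ) * ‖f i j k y‖) := by
          rw [← mul_assoc, ← Real.rpow_add hy0, neg_add_eq_sub, add_sub_cancel_right,
            Real.rpow_natCast]
      _ ≤ 2 ^ |σ| * R ^ (-σ) * m y := by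
          gcongr
          exact hfm i j k y
  calc ‖F (R / 4) x‖ ≤ ∫ p in unitCube,
        8 * (2 ^ |σ| * R ^ (-σ) * m (x + shift (fun _ => R / 4) p)) :=
        norm_integral_le_of_norm_le ((hint.const_mul _).const_mul _)
          ((ae_restrict_iff' measurableSet_unitCube).2 (.of_forall hpt))
    _ ≤ 8 * (2 ^ |σ| * R ^ (-σ) * ((R / 4) ^ (-(3 / 2) : ℝ) * A)) := by
        rw [integral_const_mul, integral_const_mul]
        gcongr
    _ = 64 * 2 ^ |σ| * A * R ^ (-σ - 3 / 2) := by
        have h4 : (4 : ℝ) ^ (-(3 / 2) : ℝ) = 1 / 8 := by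
          rw [show (4 : ℝ) = 2 ^ (2 : ℝ) by norm_num, ← Real.rpow_mul (by norm_num)]
          norm_num
        rw [Real.div_rpow hR0.le (by norm_num), h4, sub_eq_add_neg (-σ), Real.rpow_add hR0]
        ring

end Sobolev

/-! ### The product rule for weak derivatives -/

section WeakAlgebra

variable {W : Type} [NormedAddCommGroup W] [NormedSpace ℝ W]

lemma integrable_test {φ : Space → ℝ} (hφ : Continuous φ) (hc : HasCompactSupport φ)
    {f : Space → W} (hf : LocallyIntegrable f) : Integrable fun x => φ x • f x :=
  hf.integrable_smul_left_of_hasCompactSupport hφ hc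

lemma integrable_fderiv_test {φ : Space → ℝ} (hφ : ContDiff ℝ ∞ φ) (hc : HasCompactSupport φ)
    (e : Space) {f : Space → W} (hf : LocallyIntegrable f) :
    Integrable fun x => (fderiv ℝ φ x e) • f x :=
  integrable_test ((hφ.continuous_fderiv (by simp)).clm_apply continuous_const)
    (hc.fderiv_apply (𝕜 := ℝ) e) hf

lemma HasWeakPartial.add {i : Fin 3} {f f' g g' : Space → W} (h : HasWeakPartial i f g)
    (h' : HasWeakPartial i f' g') (hf : LocallyIntegrable f) (hf' : LocallyIntegrable f')
    (hg : LocallyIntegrable g) (hg' : LocallyIntegrable g') :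
    HasWeakPartial i (f + f') (g + g') := by
  intro φ hφ hc
  simp only [Pi.add_apply, smul_add]
  rw [integral_add (integrable_fderiv_test hφ hc _ hf) (integrable_fderiv_test hφ hc _ hf'),
    integral_add (integrable_test hφ.continuous hc hg) (integrable_test hφ.continuous hc hg'),
    h φ hφ hc, h' φ hφ hc, neg_add]

lemma HasWeakPartial.const_smul {i : Fin 3} {f g : Space → W} (c : ℝ) (h : HasWeakPartial i f g) :
    HasWeakPartial i (c • f) (c • g) := by
  intro φ hφ hc
  simp only [Pi.smul_apply, smul_comm _ c]
  rw [integral_smul, integral_smul, h φ hφ hc, smul_neg]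

lemma locallyIntegrable_coord_smul (j : Fin 3) {f : Space → W} (hf : LocallyIntegrable f) :
    LocallyIntegrable fun x => x j • f x := by
  rw [← locallyIntegrableOn_univ] at hf ⊢
  exact hf.continuousOn_smul isOpen_univ.isLocallyClosed (by fun_prop)

/-- The product rule for a coordinate function. -/
lemma HasWeakPartial.coord_smul {i : Fin 3} {f g : Space → W} (h : HasWeakPartial i f g)
    (hf : LocallyIntegrable f) (hg : LocallyIntegrable g) (j : Fin 3) :
    HasWeakPartial i (fun x => x j • f x)
      (fun x => x j • g x + (if j = i then (1 : ℝ) else 0) • f x) := by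
  intro φ hφ hc
  set e : Space := EuclideanSpace.single i 1
  have hcoord : ContDiff ℝ ∞ fun x : Space => x j := by fun_prop
  have hd : ∀ x, fderiv ℝ (fun x : Space => φ x * x j) x e
      = x j * fderiv ℝ φ x e + (if j = i then (1 : ℝ) else 0) * φ x := by
    intro x
    have h1 : HasFDerivAt (fun x : Space => x j)
        (EuclideanSpace.proj j : Space →L[ℝ] ℝ) x :=
      (EuclideanSpace.proj j : Space →L[ℝ] ℝ).hasFDerivAt
    change fderiv ℝ (φ * fun x : Space => x j) x e = _
    rw [(((hφ.differentiable (by simp)) x).hasFDerivAt.mul h1).fderiv]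
    simp [e]
    ring
  have key := h (fun x => φ x * x j) (hφ.mul hcoord) hc.mul_right
  have hj := locallyIntegrable_coord_smul j hf
  have hjg := locallyIntegrable_coord_smul j hg
  have hi1 := integrable_fderiv_test hφ hc e hj
  have hi2 : Integrable fun x => φ x • (if j = i then (1 : ℝ) else 0) • f x :=
    integrable_test hφ.continuous hc (hf.smul _)
  have e1 : ∫ x, (fderiv ℝ (fun x : Space => φ x * x j) x e) • f x
      = (∫ x, (fderiv ℝ φ x e) • x j • f x) + ∫ x, φ x • (if j = i then (1 : ℝ) else 0) • f x := by
    rw [← integral_add hi1 hi2]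
    refine integral_congr_ae (.of_forall fun x => ?_)
    simp only [hd]
    module
  rw [e1] at key
  have e2 : ∫ x, φ x • (x j • g x + (if j = i then (1 : ℝ) else 0) • f x)
      = (∫ x, (φ x * x j) • g x) + ∫ x, φ x • (if j = i then (1 : ℝ) else 0) • f x := by
    simp only [smul_add, mul_smul]
    exact integral_add (integrable_test hφ.continuous hc hjg) hi2
  rw [e2, neg_add, ← key]
  abel

end WeakAlgebra

/-! ### Commutators on families of derivatives -/

section JetAlgebra

variable {W : Type} [NormedAddCommGroup W] [NormedSpace ℝ W]

lemma Jet.partial_add (α : Fin 4) (v w : Jet W) : (v + w).partial α = v.partial α + w.partial α :=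
  rfl

lemma Jet.partial_smul (α : Fin 4) (c : ℝ) (v : Jet W) : (c • v).partial α = c • v.partial α :=
  rfl

lemma Jet.partial_neg (α : Fin 4) (v : Jet W) : (-v).partial α = -v.partial α :=
  rfl

lemma Jet.partial_comm (α β : Fin 4) (v : Jet W) :
    (v.partial α).partial β = (v.partial β).partial α := by
  funext a
  simp only [Jet.partial, add_right_comm]

lemma Jet.mulCoord_add (t : ℝ) (α : Fin 4) (v w : Jet W) :
    (v + w).mulCoord t α = v.mulCoord t α + w.mulCoord t α := by
  funext a x
  simp only [Jet.mulCoord, Pi.add_apply]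
  module

lemma Jet.mulCoord_smul (t : ℝ) (α : Fin 4) (c : ℝ) (v : Jet W) :
    (c • v).mulCoord t α = c • v.mulCoord t α := by
  funext a x
  simp only [Jet.mulCoord, Pi.smul_apply]
  module

/-- The commutator `[∂_β, x^α] = δ_{αβ}`. -/
lemma Jet.partial_mulCoord (t : ℝ) (α β : Fin 4) (v : Jet W) :
    (v.mulCoord t α).partial β
      = (v.partial β).mulCoord t α + (if α = β then (1 : ℝ) else 0) • v := by
  funext a x
  simp only [Jet.mulCoord, Jet.partial, Pi.add_apply, Pi.smul_apply, Pi.single_apply]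
  by_cases h : α = β
  · subst h
    have e1 : a + Pi.single α 1 - Pi.single α 1 = a := by
      funext γ
      simp
    rw [e1]
    by_cases ha : a α = 0
    · simp [ha]
    · have e2 : a - Pi.single α 1 + Pi.single α 1 = a := by
        funext γ
        by_cases hγ : γ = α
        · subst hγ
          simp
          omega
        · simp [hγ]
      rw [e2]
      simp
      module
  · simp only [h, if_false, add_zero, zero_smul]
    by_cases ha : a α = 0
    · simp [ha]
    · have e2 : a + Pi.single β 1 - Pi.single α 1 = a - Pi.single α 1 + Pi.single β 1 := by
        funext γ
        by_cases hγ : γ = α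
        · subst hγ
          simp [h]
        · simp [hγ]
      rw [e2]

lemma VF.act_add (t : ℝ) (Z : VF) (v w : Jet W) : Z.act t (v + w) = Z.act t v + Z.act t w := by
  cases Z with
  | d α => rfl
  | Ω α β =>
    simp only [VF.act, Jet.partial_add, Jet.mulCoord_add, smul_add]
    abel
  | S => simp only [VF.act, Jet.partial_add, Jet.mulCoord_add, Finset.sum_add_distrib]

lemma VF.act_smul (t : ℝ) (Z : VF) (c : ℝ) (v : Jet W) : Z.act t (c • v) = c • Z.act t v := by
  cases Z with
  | d α => rfl
  | Ω α β =>
    simp only [VF.act, Jet.partial_smul, Jet.mulCoord_smul]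
    module
  | S => simp only [VF.act, Jet.partial_smul, Jet.mulCoord_smul, Finset.smul_sum]

/-- The fields of `𝔏` as linear maps. -/
def VF.actL (t : ℝ) (Z : VF) : Jet W →ₗ[ℝ] Jet W where
  toFun := Z.act t
  map_add' := Z.act_add t
  map_smul' c v := Z.act_smul t c v

/-- The product `Z^I` as a linear map. -/
def iterL (t : ℝ) : List VF → (Jet W →ₗ[ℝ] Jet W)
  | [] => LinearMap.id
  | Z :: I => (Z.actL t).comp (iterL t I)

lemma iterL_apply (t : ℝ) (I : List VF) (v : Jet W) : iterL t I v = I.foldr (VF.act t) v := by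
  induction I with
  | nil => rfl
  | cons Z I ih => rw [List.foldr_cons, ← ih]; rfl

lemma iterL_append (t : ℝ) (I J : List VF) (v : Jet W) :
    iterL t (I ++ J) v = iterL t I (iterL t J v) := by
  simp only [iterL_apply, List.foldr_append]

lemma iterL_singleton (t : ℝ) (Z : VF) (v : Jet W) : iterL t [Z] v = Z.act t v := rfl

/-- The commutators `[Z, ∂_β]` are combinations of translations with coefficients of absolute value
at most `2`. -/
lemma VF.exists_act_partial (Z : VF) (β : Fin 4) : ∃ c : Fin 4 → ℝ, (∀ γ, |c γ| ≤ 2) ∧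
    ∀ (t : ℝ) (v : Jet W),
      Z.act t (v.partial β) = (Z.act t v).partial β + ∑ γ, c γ • v.partial γ := by
  have hm : ∀ α, |mink α| ≤ 1 := by
    intro α
    refine Fin.cases ?_ (fun i => ?_) α <;> simp [mink]
  cases Z with
  | d α => exact ⟨0, by simp, fun t v => by simp [VF.act, Jet.partial_comm α β]⟩
  | Ω α δ =>
    refine ⟨fun γ => mink α * (if α = β then 1 else 0) * (if γ = δ then 1 else 0)
      - mink δ * (if δ = β then 1 else 0) * (if γ = α then 1 else 0), fun γ => ?_, fun t v => ?_⟩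
    · refine (abs_sub _ _).trans ?_
      have h1 := hm α
      have h2 := hm δ
      rw [abs_mul, abs_mul, abs_mul, abs_mul]
      split_ifs <;> simp <;> linarith
    · simp only [VF.act, Jet.partial_add, Jet.partial_neg, Jet.partial_smul, Jet.partial_mulCoord,
        sub_smul, Finset.sum_sub_distrib]
      by_cases h1 : α = β <;> by_cases h2 : δ = β <;>
        simp only [h1, h2, mul_smul, ← Finset.smul_sum, ite_smul, one_smul, zero_smul, smul_zero,
          Finset.sum_const_zero, Finset.sum_ite_eq', Finset.mem_univ, if_true, if_false, smul_add,
          Jet.partial_comm β] <;>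
        abel
  | S =>
    refine ⟨fun γ => -(if γ = β then 1 else 0), fun γ => ?_, fun t v => ?_⟩
    · by_cases h : γ = β <;> simp [h]
    · have e : (Jet.partial β (∑ α : Fin 4, (v.partial α).mulCoord t α) : Jet W)
          = ∑ α : Fin 4, ((v.partial α).mulCoord t α).partial β := by
        simp only [Fin.sum_univ_four, Jet.partial_add]
      simp only [VF.act, e, Jet.partial_mulCoord, Finset.sum_add_distrib, ite_smul, one_smul,
        zero_smul, neg_smul, Finset.sum_neg_distrib, Finset.sum_ite_eq', Finset.mem_univ,
        if_true, Jet.partial_comm β]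
      abel

end JetAlgebra

/-! ### Derivatives in terms of the fields of `𝔏` -/

section PointwiseEstimates

variable {W : Type} [NormedAddCommGroup W] [NormedSpace ℝ W]

/-- At the point `x` and the time `t`, all `∂ Z^J v` with `|J| ≤ k` have components of norm at most
`M`. -/
def GradBound (t : ℝ) (x : Space) (k : ℕ) (v : Jet W) (M : ℝ) : Prop :=
  ∀ J : List VF, J.length ≤ k → ∀ α, ‖iterL t J v (Pi.single α 1) x‖ ≤ M

lemma mulCoord_partial_single (t : ℝ) (x : Space) (α β γ : Fin 4) (v : Jet W) :
    (v.partial γ).mulCoord t α (Pi.single β 1) x = coord t x α • v (Pi.single β 1 + Pi.single γ 1) x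
      + (if α = β then (1 : ℝ) else 0) • v (Pi.single γ 1) x := by
  simp only [Jet.mulCoord, Jet.partial, Pi.single_apply]
  by_cases h : α = β
  · subst h
    simp
  · simp [h]

lemma norm_le_sum_abs (x : Space) : ‖x‖ ≤ |x 0| + |x 1| + |x 2| := by
  have h := abs_nonneg (x 0)
  have h' := abs_nonneg (x 1)
  have h'' := abs_nonneg (x 2)
  rw [EuclideanSpace.norm_eq, Real.sqrt_le_left (by positivity)]
  simp only [Fin.sum_univ_three, Real.norm_eq_abs]
  nlinarith [mul_nonneg h h', mul_nonneg h h'', mul_nonneg h' h'']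

lemma abs_coord_le_norm (x : Space) (i : Fin 3) : |x i| ≤ ‖x‖ := by
  rw [← Real.norm_eq_abs]
  exact PiLp.norm_apply_le x i

/-- At bounded times the fields of `𝔏` control `(1 + |x|) ∂_β`: the field `Ω_{0i}` gives
`x_i ∂_t`, and the rotations together with the scaling give `|x| ∂_i`. -/
lemma GradBound.norm_second_le {t T : ℝ} (ht : 0 ≤ t) (htT : t ≤ T) {x : Space} {v : Jet W} {M : ℝ}
    (h : GradBound t x 1 v M) (α β : Fin 4) :
    (1 + ‖x‖) * ‖v (Pi.single α 1 + Pi.single β 1) x‖ ≤ (3 * T + 12) * M := by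
  have hM : 0 ≤ M := (norm_nonneg _).trans (h [] (by simp) 0)
  have hT : 0 ≤ T := ht.trans htT
  have hG : ∀ γ, ‖v (Pi.single γ 1) x‖ ≤ M := fun γ => h [] (by simp) γ
  have hV : ∀ γ, ‖v (Pi.single α 1 + Pi.single γ 1) x‖ ≤ M := fun γ =>
    h [VF.d γ] (by simp) α
  have hδ : ∀ (P : Prop) [Decidable P] γ,
      ‖(if P then (1 : ℝ) else 0) • v (Pi.single γ 1) x‖ ≤ M := by
    intro P _ γ
    split_ifs
    · simpa using hG γ
    · simpa using hM
  have htV : ∀ γ, ‖t • v (Pi.single α 1 + Pi.single γ 1) x‖ ≤ T * M := by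
    intro γ
    rw [norm_smul, Real.norm_eq_abs, abs_of_nonneg ht]
    exact mul_le_mul htT (hV γ) (norm_nonneg _) hT
  have hx := norm_le_sum_abs x
  have hxi := abs_coord_le_norm x
  refine Fin.cases ?_ (fun i => ?_) β
  · have hb : ∀ i : Fin 3, |x i| * ‖v (Pi.single α 1 + Pi.single 0 1) x‖ ≤ (T + 3) * M := by
      intro i
      have h1 := h [VF.Ω 0 i.succ] (by simp) α
      rw [iterL_singleton] at h1
      simp only [VF.act, Pi.add_apply, mulCoord_partial_single, mink, coord,
        Fin.cons_zero, Fin.cons_succ, neg_smul, neg_neg, one_smul] at h1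
      have e : x i • v (Pi.single α 1 + Pi.single 0 1) x
          = (t • v (Pi.single α 1 + Pi.single i.succ 1) x
              + (if (0 : Fin 4) = α then (1 : ℝ) else 0) • v (Pi.single i.succ 1) x
              + (x i • v (Pi.single α 1 + Pi.single 0 1) x
              + (if i.succ = α then (1 : ℝ) else 0) • v (Pi.single 0 1) x))
            - t • v (Pi.single α 1 + Pi.single i.succ 1) x
            - (if (0 : Fin 4) = α then (1 : ℝ) else 0) • v (Pi.single i.succ 1) x
            - (if i.succ = α then (1 : ℝ) else 0) • v (Pi.single 0 1) x := by abel
      rw [← Real.norm_eq_abs, ← norm_smul, e]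
      refine (norm_sub_le _ _).trans (add_le_add ((norm_sub_le _ _).trans (add_le_add
        ((norm_sub_le _ _).trans (add_le_add h1 (htV _))) (hδ _ _))) (hδ _ _)) |>.trans ?_
      linarith
    have hn := norm_nonneg (v (Pi.single α 1 + Pi.single 0 1) x)
    nlinarith [hb 0, hb 1, hb 2, hV 0, mul_le_mul_of_nonneg_right hx hn]
  · set V : Fin 3 → W := fun j => v (Pi.single α 1 + Pi.single j.succ 1) x
    have hrot : ∀ j : Fin 3, ‖x j • V i - x i • V j‖ ≤ 3 * M := by
      intro j
      have h1 := h [VF.Ω i.succ j.succ] (by simp) α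
      rw [iterL_singleton] at h1
      simp only [VF.act, Pi.add_apply, Pi.neg_apply, mulCoord_partial_single, mink, coord,
        Fin.cons_succ, one_smul] at h1
      have e : x j • V i - x i • V j
          = (-(x i • V j + (if i.succ = α then (1 : ℝ) else 0) • v (Pi.single j.succ 1) x)
              + (x j • V i + (if j.succ = α then (1 : ℝ) else 0) • v (Pi.single i.succ 1) x))
            + (if i.succ = α then (1 : ℝ) else 0) • v (Pi.single j.succ 1) x
            - (if j.succ = α then (1 : ℝ) else 0) • v (Pi.single i.succ 1) x := by abel
      rw [e]
      refine (norm_sub_le _ _).trans (add_le_add ((norm_add_le _ _).trans (add_le_add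
        h1 (hδ _ _))) (hδ _ _)) |>.trans ?_
      linarith
    have hscal : ‖x 0 • V 0 + x 1 • V 1 + x 2 • V 2‖ ≤ (T + 2) * M := by
      have h1 := h [VF.S] (by simp) α
      rw [iterL_singleton] at h1
      simp only [VF.act, Finset.sum_apply, mulCoord_partial_single, Finset.sum_add_distrib,
        ite_smul, one_smul, zero_smul, Finset.sum_ite_eq', Finset.mem_univ, if_true] at h1
      rw [Fin.sum_univ_succ, Fin.sum_univ_three] at h1
      simp only [coord, Fin.cons_zero, Fin.cons_succ] at h1
      have e : x 0 • V 0 + x 1 • V 1 + x 2 • V 2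
          = (t • v (Pi.single α 1 + Pi.single 0 1) x + (x 0 • V 0 + x 1 • V 1 + x 2 • V 2)
            + v (Pi.single α 1) x) - t • v (Pi.single α 1 + Pi.single 0 1) x
            - v (Pi.single α 1) x := by abel
      rw [e]
      refine (norm_sub_le _ _).trans (add_le_add ((norm_sub_le _ _).trans (add_le_add
        h1 (htV _))) (hG _)) |>.trans ?_
      linarith
    have hr : ‖x‖ * ‖V i‖ ≤ (T + 11) * M := by
      rcases (norm_nonneg x).eq_or_lt with h0 | h0
      · rw [← h0, zero_mul]
        positivity
      refine le_of_mul_le_mul_left ?_ h0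
      have hsq : ‖x‖ ^ 2 = x 0 ^ 2 + x 1 ^ 2 + x 2 ^ 2 := by
        rw [EuclideanSpace.norm_sq_eq, Fin.sum_univ_three]
        simp
      have e : ‖x‖ ^ 2 • V i = x 0 • (x 0 • V i - x i • V 0) + x 1 • (x 1 • V i - x i • V 1)
          + x 2 • (x 2 • V i - x i • V 2) + x i • (x 0 • V 0 + x 1 • V 1 + x 2 • V 2) := by
        rw [hsq]
        module
      have hb : ∀ (j : Fin 3) (w : W) (B : ℝ), ‖w‖ ≤ B → ‖x j • w‖ ≤ ‖x‖ * B := by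
        intro j w B hw
        rw [norm_smul, Real.norm_eq_abs]
        exact mul_le_mul (hxi j) hw (norm_nonneg _) h0.le
      calc ‖x‖ * (‖x‖ * ‖V i‖) = ‖‖x‖ ^ 2 • V i‖ := by
            rw [norm_smul, Real.norm_eq_abs, abs_of_nonneg (by positivity)]
            ring
        _ ≤ ‖x‖ * (3 * M) + ‖x‖ * (3 * M) + ‖x‖ * (3 * M) + ‖x‖ * ((T + 2) * M) := by
            rw [e]
            exact (norm_add_le _ _).trans (add_le_add ((norm_add_le _ _).trans (add_le_add
              ((norm_add_le _ _).trans (add_le_add (hb _ _ _ (hrot 0)) (hb _ _ _ (hrot 1))))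
              (hb _ _ _ (hrot 2)))) (hb _ _ _ hscal))
        _ = ‖x‖ * ((T + 11) * M) := by ring
    have := hV i.succ
    change (1 + ‖x‖) * ‖V i‖ ≤ _
    change ‖V i‖ ≤ M at this
    nlinarith [mul_nonneg hT hM]

lemma GradBound.mono {t : ℝ} {x : Space} {k l : ℕ} (hkl : k ≤ l) {v : Jet W} {M : ℝ}
    (h : GradBound t x l v M) : GradBound t x k v M := fun J hJ => h J (hJ.trans hkl)

/-- A translation costs one field and gains the factor `1 + |x|`. -/
lemma GradBound.partial {t T : ℝ} (ht : 0 ≤ t) (htT : t ≤ T) {x : Space} {k : ℕ} {v : Jet W}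
    {M : ℝ} (h : GradBound t x (k + 1) v M) (β : Fin 4) :
    GradBound t x k (v.partial β) (9 ^ k * (3 * T + 12) * M / (1 + ‖x‖)) := by
  have hx : 0 < 1 + ‖x‖ := by positivity
  induction k generalizing v β with
  | zero =>
    intro J hJ α
    obtain rfl := List.length_eq_zero_iff.1 (Nat.le_zero.1 hJ)
    rw [le_div_iff₀' hx, pow_zero, one_mul]
    exact h.norm_second_le ht htT α β
  | succ k ih =>
    have hM : 0 ≤ M := (norm_nonneg _).trans (h [] (by simp) 0)
    have hT : 0 ≤ T := ht.trans htT
    set B := 9 ^ k * (3 * T + 12) * M / (1 + ‖x‖)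
    have hB : 0 ≤ B := by positivity
    have hle : 9 ^ (k + 1) * (3 * T + 12) * M / (1 + ‖x‖) = 9 * B := by
      simp only [B]
      ring
    rw [hle]
    intro J hJ α
    rcases List.eq_nil_or_concat J with rfl | ⟨J, Z, rfl⟩
    · have h1 := ih (h.mono (by omega)) β [] (by simp) α
      linarith
    · simp only [List.concat_eq_append, List.length_append, List.length_singleton] at hJ
      obtain ⟨c, hc, hcomm⟩ := Z.exists_act_partial (W := W) β
      have hZ : GradBound t x (k + 1) (Z.act t v) M := by
        intro I hI γ
        rw [← iterL_singleton, ← iterL_append]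
        exact h _ (by simp; omega) γ
      rw [List.concat_eq_append, iterL_append, iterL_singleton, hcomm, map_add, map_sum]
      simp only [Pi.add_apply, Finset.sum_apply, map_smul, Pi.smul_apply]
      have h1 := ih hZ β J (by omega) α
      have h2 : ∀ γ, ‖c γ • iterL t J (v.partial γ) (Pi.single α 1) x‖ ≤ 2 * B := by
        intro γ
        rw [norm_smul, Real.norm_eq_abs]
        exact mul_le_mul (hc γ) (ih (h.mono (by omega)) γ J (by omega) α) (norm_nonneg _)
          (by norm_num)
      refine (norm_add_le _ _).trans
        ((add_le_add h1 (norm_sum_le_of_le _ fun γ _ => h2 γ)).trans ?_)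
      simp
      linarith

/-- Every derivative of a gradient, of order at most `3`, gains a factor `1 + |x|`. -/
lemma GradBound.norm_deriv_le {t T : ℝ} (ht : 0 ≤ t) (htT : t ≤ T) {x : Space} {n : ℕ} (hn : n ≤ 3)
    {v : Jet W} {M : ℝ} (h : GradBound t x n v M) (α : Fin 4) (c : Fin 4 → ℕ) (hc : ∑ β, c β = n) :
    (1 + ‖x‖) ^ n * ‖v (Pi.single α 1 + c) x‖ ≤ (9 ^ 3 * (3 * T + 12)) ^ n * M := by
  have hx : 0 < 1 + ‖x‖ := by positivity
  have hT : 0 ≤ T := ht.trans htT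
  induction n generalizing v M c with
  | zero =>
    have : c = 0 := by
      funext β
      exact (Finset.sum_eq_zero_iff.1 hc) β (Finset.mem_univ _)
    subst this
    simpa [iterL] using h [] (by simp) α
  | succ n ih =>
    have hM : 0 ≤ M := (norm_nonneg _).trans (h [] (by simp) 0)
    obtain ⟨β, hβ⟩ : ∃ β, c β ≠ 0 := by
      by_contra hcon
      push Not at hcon
      simp [hcon] at hc
    have hcβ : c - Pi.single β 1 + Pi.single β 1 = c := by
      funext γ
      by_cases hγ : γ = β
      · subst hγ
        simp
        omega
      · simp [hγ]
    have hsum : ∑ γ, (c - Pi.single β 1 : Fin 4 → ℕ) γ = n := by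
      have h1 : ∑ γ, c γ
          = ∑ γ, (c - Pi.single β 1 : Fin 4 → ℕ) γ + ∑ γ, (Pi.single β 1 : Fin 4 → ℕ) γ := by
        rw [← Finset.sum_add_distrib]
        exact Finset.sum_congr rfl fun γ _ => (congrFun hcβ γ).symm
      rw [Finset.sum_pi_single', if_pos (Finset.mem_univ _)] at h1
      omega
    have h1 := ih (by omega) (h.partial ht htT β) (c - Pi.single β 1) hsum
    rw [Jet.partial, add_assoc, hcβ] at h1
    have h9 : (9 : ℝ) ^ n ≤ 9 ^ 3 := pow_le_pow_right₀ (by norm_num) (by omega)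
    calc (1 + ‖x‖) ^ (n + 1) * ‖v (Pi.single α 1 + c) x‖
        = (1 + ‖x‖) * ((1 + ‖x‖) ^ n * ‖v (Pi.single α 1 + c) x‖) := by ring
      _ ≤ (1 + ‖x‖) * ((9 ^ 3 * (3 * T + 12)) ^ n * (9 ^ n * (3 * T + 12) * M / (1 + ‖x‖))) := by
          gcongr
      _ = (9 ^ 3 * (3 * T + 12)) ^ n * (9 ^ n * (3 * T + 12) * M) := by
          field_simp
      _ ≤ (9 ^ 3 * (3 * T + 12)) ^ n * (9 ^ 3 * (3 * T + 12) * M) := by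
          gcongr
      _ = (9 ^ 3 * (3 * T + 12)) ^ (n + 1) * M := by ring

end PointwiseEstimates

/-! ### Weak differentiability of `Z^I u` -/

section Regularity

variable {W : Type} [NormedAddCommGroup W] [NormedSpace ℝ W]

/-- The members of the family are locally integrable functions, and those of order at most `m` are
related by weak spatial derivatives as their indices tell. -/
structure Jet.Regular (m : ℕ) (v : Jet W) : Prop where
  stronglyMeasurable : ∀ a, StronglyMeasurable (v a)
  locallyIntegrable : ∀ a, LocallyIntegrable (v a)
  hasWeakPartial : ∀ (a : Fin 4 → ℕ) (i : Fin 3), ∑ γ, a γ < m →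
    HasWeakPartial i (v a) (v (a + Pi.single i.succ 1))

lemma Jet.Regular.partial {m : ℕ} {v : Jet W} (h : v.Regular (m + 1)) (β : Fin 4) :
    (v.partial β).Regular m where
  stronglyMeasurable _ := h.stronglyMeasurable _
  locallyIntegrable _ := h.locallyIntegrable _
  hasWeakPartial a i ha := by
    have := h.hasWeakPartial (a + Pi.single β 1) i (by
      simp only [Pi.add_apply, Finset.sum_add_distrib, Finset.sum_pi_single', Finset.mem_univ,
        if_true]
      omega)
    rwa [add_right_comm] at this

lemma Jet.Regular.mono {m n : ℕ} (hmn : m ≤ n) {v : Jet W} (h : v.Regular n) : v.Regular m :=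
  ⟨h.1, h.2, fun a i ha => h.3 a i (ha.trans_le hmn)⟩

lemma Jet.Regular.add {m : ℕ} {v w : Jet W} (hv : v.Regular m) (hw : w.Regular m) :
    (v + w).Regular m where
  stronglyMeasurable a := (hv.1 a).add (hw.1 a)
  locallyIntegrable a := (hv.2 a).add (hw.2 a)
  hasWeakPartial a i ha := (hv.3 a i ha).add (hw.3 a i ha) (hv.2 _) (hw.2 _) (hv.2 _) (hw.2 _)

lemma Jet.Regular.smul {m : ℕ} {v : Jet W} (hv : v.Regular m) (c : ℝ) : (c • v).Regular m where
  stronglyMeasurable a := (hv.1 a).const_smul c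
  locallyIntegrable a := (hv.2 a).smul c
  hasWeakPartial a i ha := (hv.3 a i ha).const_smul c

lemma Jet.Regular.neg {m : ℕ} {v : Jet W} (hv : v.Regular m) : (-v).Regular m := by
  rw [← neg_one_smul ℝ]
  exact hv.smul (-1)

lemma continuous_coord (t : ℝ) (α : Fin 4) : Continuous fun x : Space => coord t x α := by
  refine Fin.cases ?_ (fun i => ?_) α
  · exact continuous_const
  · simp only [coord, Fin.cons_succ]
    fun_prop

lemma HasWeakPartial.spacetime_coord_smul {i : Fin 3} {f g : Space → W} (h : HasWeakPartial i f g)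
    (hf : LocallyIntegrable f) (hg : LocallyIntegrable g) (t : ℝ) (α : Fin 4) :
    HasWeakPartial i (fun x => coord t x α • f x)
      (fun x => coord t x α • g x + (if α = i.succ then (1 : ℝ) else 0) • f x) := by
  refine Fin.cases ?_ (fun j => ?_) α
  · simp only [coord, Fin.cons_zero, (Fin.succ_ne_zero i).symm, if_false, zero_smul, add_zero]
    exact h.const_smul t
  · simp only [coord, Fin.cons_succ, Fin.succ_inj]
    exact h.coord_smul hf hg j

lemma locallyIntegrable_spacetime_coord_smul (t : ℝ) (α : Fin 4) {f : Space → W}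
    (hf : LocallyIntegrable f) : LocallyIntegrable fun x => coord t x α • f x :=
  hf.continuous_smul (continuous_coord t α)

lemma Jet.Regular.mulCoord {m : ℕ} {v : Jet W} (hv : v.Regular m) (t : ℝ) (α : Fin 4) :
    (v.mulCoord t α).Regular m where
  stronglyMeasurable a :=
    ((continuous_coord t α).stronglyMeasurable.smul (hv.1 a)).add ((hv.1 _).const_smul _)
  locallyIntegrable a :=
    (locallyIntegrable_spacetime_coord_smul t α (hv.2 a)).add ((hv.2 _).smul _)
  hasWeakPartial a i ha := by
    have e : v.mulCoord t α (a + Pi.single i.succ 1)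
        = (fun x => coord t x α • v (a + Pi.single i.succ 1) x
            + (if α = i.succ then (1 : ℝ) else 0) • v a x)
          + (a α : ℝ) • v (a - Pi.single α 1 + Pi.single i.succ 1) := by
      have := congrFun (Jet.partial_mulCoord t α i.succ v) a
      simp only [Jet.partial] at this
      funext x
      rw [this]
      simp only [Jet.mulCoord, Jet.partial, Pi.add_apply, Pi.smul_apply]
      abel
    rw [e]
    refine ((hv.3 a i ha).spacetime_coord_smul (hv.2 _) (hv.2 _) t α).add
      (HasWeakPartial.const_smul _ (hv.3 (a - Pi.single α 1) i ?_))
      (locallyIntegrable_spacetime_coord_smul t α (hv.2 _)) ((hv.2 _).smul _)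
      ((locallyIntegrable_spacetime_coord_smul t α (hv.2 _)).add ((hv.2 _).smul _))
      ((hv.2 _).smul _)
    exact (Finset.sum_le_sum fun γ _ => Nat.sub_le _ _).trans_lt ha

lemma Jet.Regular.act {m : ℕ} {v : Jet W} (hv : v.Regular (m + 1)) (t : ℝ) (Z : VF) :
    (Z.act t v).Regular m := by
  cases Z with
  | d α => exact hv.partial α
  | Ω α β =>
    exact (((hv.partial β).mulCoord t α).smul _).neg.add (((hv.partial α).mulCoord t β).smul _)
  | S =>
    simp only [VF.act, Fin.sum_univ_four]
    exact ((((hv.partial 0).mulCoord t 0).add ((hv.partial 1).mulCoord t 1)).add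
      ((hv.partial 2).mulCoord t 2)).add ((hv.partial 3).mulCoord t 3)

lemma Jet.Regular.iterL {m : ℕ} {v : Jet W} (t : ℝ) (I : List VF)
    (hv : v.Regular (m + I.length)) : (EYMH.iterL t I v).Regular m := by
  induction I generalizing m with
  | nil => exact hv
  | cons Z I ih =>
    refine Jet.Regular.act (ih (m := m + 1) ?_) t Z
    rw [List.length_cons] at hv
    convert hv using 1
    ring

end Regularity

/-! ### Functions of class `E_s(T)` -/

section TimeDerivatives

variable {W : Type} [NormedAddCommGroup W] [NormedSpace ℝ W]

lemma locallyIntegrable_L2 (f : L2 W) : LocallyIntegrable f :=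
  (Lp.memLp f).locallyIntegrable (by norm_num)

/-- Weak derivatives in `L²` are unique. -/
lemma IsWeakPartial.unique [CompleteSpace W] {i : Fin 3} {f g g' : L2 W} (h : IsWeakPartial i f g)
    (h' : IsWeakPartial i f g') : g = g' := by
  refine Lp.ext (ae_eq_of_integral_contDiff_smul_eq (locallyIntegrable_L2 g)
    (locallyIntegrable_L2 g') fun φ hφ hc => ?_)
  exact neg_injective ((h φ hφ hc).symm.trans (h' φ hφ hc))

lemma IsWeakPartial.weakPartial_eq [CompleteSpace W] {i : Fin 3} {f g : L2 W}
    (h : IsWeakPartial i f g) : weakPartial i f = g := by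
  have hex : ∃ g, IsWeakPartial i f g := ⟨g, h⟩
  rw [weakPartial, dif_pos hex]
  exact hex.choose_spec.unique h

lemma iterate_weakPartial_eq [CompleteSpace W] {i : Fin 3} (G : ℕ → L2 W) {n : ℕ}
    (h : ∀ j < n, IsWeakPartial i (G j) (G (j + 1))) : (weakPartial i)^[n] (G 0) = G n := by
  induction n with
  | zero => rfl
  | succ n ih =>
    rw [Function.iterate_succ_apply', ih fun j hj => h j (hj.trans n.lt_succ_self)]
    exact (h n n.lt_succ_self).weakPartial_eq

/-- The components of an element of `H_k` are the weak derivatives of the underlying function. -/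
lemma weakDeriv_toL2 [CompleteSpace W] {k : ℕ} (F : sobolevH k W) (b : MultiIndex k) :
    weakDeriv b.1 (sobolevH.toL2 F) = F.1 b := by
  classical
  obtain ⟨b, hb⟩ := b
  have hs : ∑ i, b i = b 0 + b 1 + b 2 := Fin.sum_univ_three _
  -- the family along a path of multi-indices, extended by `0` beyond the order `k`
  set G : (Fin 3 → ℕ) → L2 W := fun c => if h : ∑ i, c i ≤ k then F.1 ⟨c, h⟩ else 0
  have hG : ∀ (c : Fin 3 → ℕ) (h : ∑ i, c i ≤ k), G c = F.1 ⟨c, h⟩ := fun c h => dif_pos h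
  have hstep : ∀ (c d : Fin 3 → ℕ) (i : Fin 3), d = c + Pi.single i 1 → ∑ j, d j ≤ k →
      IsWeakPartial i (G c) (G d) := by
    intro c d i hcd hd
    have hc : ∑ j, c j ≤ k := le_trans (Finset.sum_le_sum fun j _ => by simp [hcd]) hd
    rw [hG c hc, hG d hd]
    exact F.2 ⟨c, hc⟩ ⟨d, hd⟩ i hcd
  have e2 : (weakPartial 2)^[b 2] (G ![0, 0, 0]) = G ![0, 0, b 2] := by
    refine iterate_weakPartial_eq (fun n => G ![0, 0, n]) fun j hj => hstep _ _ 2 ?_ ?_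
    · ext l; fin_cases l <;> simp
    · simp [Fin.sum_univ_three]; omega
  have e1 : (weakPartial 1)^[b 1] (G ![0, 0, b 2]) = G ![0, b 1, b 2] := by
    refine iterate_weakPartial_eq (fun n => G ![0, n, b 2]) fun j hj => hstep _ _ 1 ?_ ?_
    · ext l; fin_cases l <;> simp
    · simp [Fin.sum_univ_three]; omega
  have e0 : (weakPartial 0)^[b 0] (G ![0, b 1, b 2]) = G ![b 0, b 1, b 2] := by
    refine iterate_weakPartial_eq (fun n => G ![n, b 1, b 2]) fun j hj => hstep _ _ 0 ?_ ?_
    · ext l; fin_cases l <;> simp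
    · simp [Fin.sum_univ_three]; omega
  have hb' : ![b 0, b 1, b 2] = b := by
    ext l; fin_cases l <;> simp
  have h0 : sobolevH.toL2 F = G ![0, 0, 0] := by
    rw [hG _ (by simp [Fin.sum_univ_three]), sobolevH.toL2]
    refine congrArg F.1 (Subtype.ext (funext fun l => ?_))
    fin_cases l <;> simp
  rw [weakDeriv, h0, e2, e1, e0, hb', hG b hb]

/-- The underlying `L²` function, as a continuous linear map. -/
def toL2CLM (k : ℕ) : sobolevH k W →L[ℝ] L2 W :=
  (ContinuousLinearMap.proj (R := ℝ) (φ := fun _ : MultiIndex k => L2 W) ⟨0, by simp⟩).comp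
    (sobolevH k W).subtypeL

lemma MemE.exists_sobolev {s : ℕ} {T : ℝ} {u : ℝ → L2 W} (hu : MemE s T u) {k l : ℕ}
    (hkl : k + l ≤ s) {t : ℝ} (ht : t ∈ Ico 0 T) :
    ∃ F : sobolevH k W, sobolevH.toL2 F = iteratedDerivWithin l u (Ico 0 T) t := by
  obtain ⟨U, hU, hUu⟩ := hu k (by omega)
  refine ⟨iteratedDerivWithin l U (Ico 0 T) t, ?_⟩
  have e : EqOn u (toL2CLM k ∘ U) (Ico 0 T) := fun r hr => (hUu r hr).symm
  rw [iteratedDerivWithin_congr e ht, iteratedDerivWithin, iteratedDerivWithin,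
    ContinuousLinearMap.iteratedFDerivWithin_comp_left (toL2CLM k) (hU t ht) (uniqueDiffOn_Ico 0 T)
      ht (by exact_mod_cast (show l ≤ s - k by omega))]
  rfl

/-- The derivatives of order at most `s` of a function of class `E_s(T)` are related by weak
differentiation. -/
lemma MemE.regular_jetAt [CompleteSpace W] {s : ℕ} {T : ℝ} {u : ℝ → L2 W} (hu : MemE s T u) {t : ℝ}
    (ht : t ∈ Ico 0 T) : (jetAt T u t).Regular s where
  stronglyMeasurable a := Lp.stronglyMeasurable _
  locallyIntegrable a := locallyIntegrable_L2 _
  hasWeakPartial a i ha := by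
    have hsum : ∑ γ, a γ = a 0 + ∑ j : Fin 3, a j.succ := Fin.sum_univ_succ _
    obtain ⟨F, hF⟩ := hu.exists_sobolev (k := s - a 0) (l := a 0) (by omega) ht
    have hb : ∑ j : Fin 3, a j.succ ≤ s - a 0 := by omega
    have hc' : ∀ j : Fin 3, (a + Pi.single i.succ 1 : Fin 4 → ℕ) j.succ
        = a j.succ + (Pi.single i 1 : Fin 3 → ℕ) j := by
      intro j
      simp [Pi.single_apply]
    have hc : ∑ j : Fin 3, (a + Pi.single i.succ 1 : Fin 4 → ℕ) j.succ ≤ s - a 0 := by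
      simp only [hc', Finset.sum_add_distrib, Finset.sum_pi_single', Finset.mem_univ, if_true]
      omega
    have h0 : (a + Pi.single i.succ 1 : Fin 4 → ℕ) 0 = a 0 := by
      simp
    simp only [jetAt, h0, ← hF]
    rw [weakDeriv_toL2 F ⟨fun j : Fin 3 => a j.succ, hb⟩,
      weakDeriv_toL2 F ⟨fun j : Fin 3 => (a + Pi.single i.succ 1 : Fin 4 → ℕ) j.succ, hc⟩]
    exact F.2 _ _ i (funext hc')

end TimeDerivatives

/-! ### Integration along half lines -/

section Ray

variable {W : Type} [NormedAddCommGroup W] [NormedSpace ℝ W]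

lemma integral_unitInterval_rpow {R s p : ℝ} (hR : 0 < R) (hs : 0 ≤ s) (hp : p ≠ -1) :
    ∫ a in Icc (0 : ℝ) 1, s * (R + s * a) ^ p = ((R + s) ^ (p + 1) - R ^ (p + 1)) / (p + 1) := by
  have hp1 : p + 1 ≠ 0 := fun h => hp (by linarith)
  have hpos : ∀ a ∈ Icc (0 : ℝ) 1, 0 < R + s * a := fun a ha => by
    have := mul_nonneg hs ha.1
    linarith
  rw [integral_Icc_eq_integral_Ioc, ← intervalIntegral.integral_of_le zero_le_one]
  have hd : ∀ a ∈ uIcc (0 : ℝ) 1, HasDerivAt (fun a => (R + s * a) ^ (p + 1) / (p + 1))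
      (s * (R + s * a) ^ p) a := by
    intro a ha
    rw [uIcc_of_le zero_le_one] at ha
    have h1 : HasDerivAt (fun a => R + s * a) s a := by
      simpa using ((hasDerivAt_id a).const_mul s).const_add R
    refine ((h1.rpow_const (Or.inl (hpos a ha).ne') (p := p + 1)).div_const (p + 1)).congr_deriv ?_
    rw [add_sub_cancel_right]
    field_simp
  have hc : ContinuousOn (fun a => s * (R + s * a) ^ p) (uIcc 0 1) := by
    rw [uIcc_of_le zero_le_one]
    exact continuousOn_const.mul (ContinuousOn.rpow_const (by fun_prop)
      fun a ha => Or.inl (hpos a ha).ne')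
  rw [intervalIntegral.integral_eq_sub_of_hasDerivAt hd hc.intervalIntegrable]
  simp
  ring

lemma integral_unitCube_fst (g : ℝ → ℝ) :
    ∫ p in unitCube, g p.1 = ∫ a in Icc (0 : ℝ) 1, g a := by
  have : IsProbabilityMeasure ((volume : Measure ℝ).restrict (Icc 0 1)) := ⟨by simp⟩
  rw [unitCube, Measure.volume_eq_prod, ← Measure.prod_restrict, integral_fun_fst,
    Measure.volume_eq_prod, ← Measure.prod_restrict]
  simp

/-- A function which tends to zero at infinity, and whose weak derivative `∂₁` decays, is estimated
by integration along the half line in the direction `± e₁` that leads away from the origin. -/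
lemma norm_le_of_weakPartial_decay [CompleteSpace W] {U V : Space → W} (hU : Continuous U)
    (hV : Continuous V) (h : HasWeakPartial 0 U V) {B G γ : ℝ} (hγ : 0 < γ)
    (hγ1 : γ < 1) (hG : 0 ≤ G)
    (hUB : ∀ x, ‖U x‖ ≤ B * (1 + ‖x‖) ^ (-1 : ℝ)) (hVG : ∀ x, ‖V x‖ ≤ G * (1 + ‖x‖) ^ (-2 - γ))
    (x : Space) : ‖U x‖ ≤ 8 * G * (1 + ‖x‖) ^ (-1 - γ) := by
  have hB : 0 ≤ B := by
    have := (norm_nonneg _).trans (hUB 0)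
    simpa using this
  set R : ℝ := 1 + ‖x‖
  have hR : 1 ≤ R := by simp [R]
  have hR0 : 0 < R := by linarith
  -- the sign of the first coordinate
  obtain ⟨e, he, hxe⟩ : ∃ e : ℝ, |e| = 1 ∧ 0 ≤ e * x 0 := by
    rcases le_total 0 (x 0) with hx | hx
    · exact ⟨1, by simp, by linarith⟩
    · exact ⟨-1, by simp, by linarith⟩
  have hee : e ^ 2 = 1 := by rw [← sq_abs, he, one_pow]
  have key : ∀ s : ℝ, 0 < s →
      ‖U x‖ ≤ 4 * B * ((R + s) ^ (1 / 2 : ℝ) / s) + 8 * G * R ^ (-1 - γ) := by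
    intro s hs
    set ρ : Fin 3 → ℝ := ![e * s, 0, 0]
    set f : Fin 2 → Fin 2 → Fin 2 → Space → W := fun i _ _ => if i = 0 then U else V
    have hf : ∀ i j k, Continuous (f i j k) := by
      intro i j k
      simp only [f]
      split_ifs
      exacts [hU, hV]
    have hsum : ∀ p y, cubeSum ρ p (fun i j k => f i j k y)
        = U y + (-(e * s * (1 - p.1))) • V y := by
      intro p y
      simp [cubeSum, Fin.sum_univ_two, ρ, f]
    have hFc : Continuous fun x => ∫ p in unitCube,
        cubeSum ρ p (fun i j k => f i j k (x + shift ρ p)) := by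
      simp only [hsum]
      refine continuous_parametric_integral_of_continuous ?_ isCompact_unitCube
      have := continuous_shift ρ
      unfold Function.uncurry
      fun_prop
    have hrep := ae_eq_integral_cubeSum ρ f (fun i j k => (hf i j k).stronglyMeasurable)
      (fun i j k => (hf i j k).locallyIntegrable) (fun _ _ _ => by simpa [f] using h)
      (fun h1 => absurd rfl h1) (fun h2 => absurd rfl h2) hFc
    have hpt := congrFun (((hf 0 0 0).ae_eq_iff_eq volume hFc).1 hrep) x
    simp only [hsum] at hpt
    change U x = _ at hpt
    -- the points of the half line move away from the origin
    have hout : ∀ p ∈ unitCube, (R + s * p.1) / 2 ≤ 1 + ‖x + shift ρ p‖ := by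
      intro p hp
      have hp0 : 0 ≤ s * p.1 := mul_nonneg hs.le hp.1.1
      have hsq : ‖x + shift ρ p‖ ^ 2 = (x 0 + e * s * p.1) ^ 2 + x 1 ^ 2 + x 2 ^ 2 := by
        rw [EuclideanSpace.norm_sq_eq, Fin.sum_univ_three]
        simp [shift, ρ]
      have hsx : ‖x‖ ^ 2 = x 0 ^ 2 + x 1 ^ 2 + x 2 ^ 2 := by
        rw [EuclideanSpace.norm_sq_eq, Fin.sum_univ_three]
        simp
      have hexp : (x 0 + e * s * p.1) ^ 2
          = x 0 ^ 2 + 2 * ((e * x 0) * (s * p.1)) + (s * p.1) ^ 2 := by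
        have : (e * s * p.1) ^ 2 = (s * p.1) ^ 2 := by
          rw [mul_assoc, mul_pow, hee, one_mul]
        nlinarith
      have h1 : ‖x‖ ≤ ‖x + shift ρ p‖ := by
        refine (sq_le_sq₀ (norm_nonneg _) (norm_nonneg _)).1 ?_
        nlinarith [mul_nonneg hxe hp0, sq_nonneg (s * p.1)]
      have h2 : s * p.1 ≤ ‖x + shift ρ p‖ := by
        refine (sq_le_sq₀ hp0 (norm_nonneg _)).1 ?_
        nlinarith [mul_nonneg hxe hp0, sq_nonneg (x 0), sq_nonneg (x 1), sq_nonneg (x 2)]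
      simp only [R]
      linarith
    set g : ℝ → ℝ := fun a => 2 * B / s * (s * (R + s * a) ^ (-(1 / 2) : ℝ))
      + 8 * G * (s * (R + s * a) ^ (-2 - γ))
    have hpos : ∀ a ∈ Icc (0 : ℝ) 1, 0 < R + s * a := fun a ha => by
      have := mul_nonneg hs.le ha.1
      linarith
    have hcont : ∀ q : ℝ, ContinuousOn (fun a => s * (R + s * a) ^ q) (Icc 0 1) := fun q =>
      continuousOn_const.mul (ContinuousOn.rpow_const (by fun_prop)
        fun a ha => Or.inl (hpos a ha).ne')
    have hgc : ContinuousOn g (Icc 0 1) :=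
      (continuousOn_const.mul (hcont _)).add (continuousOn_const.mul (hcont _))
    have hgi : IntegrableOn (fun p : ℝ × ℝ × ℝ => g p.1) unitCube :=
      (hgc.comp continuousOn_fst fun p hp => hp.1).integrableOn_compact isCompact_unitCube
    have hbound : ∀ p ∈ unitCube, ‖U (x + shift ρ p) + (-(e * s * (1 - p.1))) • V (x + shift ρ p)‖
        ≤ g p.1 := by
      intro p hp
      have hb := hout p hp
      have hb0 := hpos p.1 hp.1
      have hb1 : 1 ≤ R + s * p.1 := by
        have := mul_nonneg hs.le hp.1.1
        linarith
      set y := x + shift ρ p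
      have hU1 : ‖U y‖ ≤ 2 * B / s * (s * (R + s * p.1) ^ (-(1 / 2) : ℝ)) := by
        calc ‖U y‖ ≤ B * (1 + ‖y‖) ^ (-1 : ℝ) := hUB y
          _ ≤ B * ((R + s * p.1) / 2) ^ (-1 : ℝ) := by
            gcongr ?_ * ?_
            exact Real.rpow_le_rpow_of_nonpos (by positivity) hb (by norm_num)
          _ = 2 * B * (R + s * p.1) ^ (-1 : ℝ) := by
            rw [Real.rpow_neg_one, Real.rpow_neg_one]
            field_simp
          _ ≤ 2 * B * (R + s * p.1) ^ (-(1 / 2) : ℝ) := by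
            gcongr ?_ * ?_
            exact Real.rpow_le_rpow_of_exponent_le hb1 (by norm_num)
          _ = 2 * B / s * (s * (R + s * p.1) ^ (-(1 / 2) : ℝ)) := by
            field_simp
      have hV1 : ‖V y‖ ≤ 8 * G * (R + s * p.1) ^ (-2 - γ) := by
        calc ‖V y‖ ≤ G * (1 + ‖y‖) ^ (-2 - γ) := hVG y
          _ ≤ G * ((R + s * p.1) / 2) ^ (-2 - γ) := by
            gcongr ?_ * ?_
            exact Real.rpow_le_rpow_of_nonpos (by positivity) hb (by linarith)
          _ = G * (2 ^ (2 + γ) * (R + s * p.1) ^ (-2 - γ)) := by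
            rw [Real.div_rpow hb0.le (by norm_num), show -2 - γ = -(2 + γ) by ring,
              Real.rpow_neg (by norm_num : (0 : ℝ) ≤ 2)]
            field_simp
          _ ≤ G * (2 ^ (3 : ℝ) * (R + s * p.1) ^ (-2 - γ)) := by
            gcongr
            · norm_num
            · linarith
          _ = 8 * G * (R + s * p.1) ^ (-2 - γ) := by
            norm_num
            ring
      refine (norm_add_le _ _).trans (add_le_add hU1 ?_)
      have h1 : |(-(e * s * (1 - p.1)))| ≤ s := by
        rw [abs_neg, abs_mul, abs_mul, he, one_mul, abs_of_pos hs,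
          abs_of_nonneg (sub_nonneg.2 hp.1.2)]
        exact mul_le_of_le_one_right hs.le (by linarith [hp.1.1])
      rw [norm_smul, Real.norm_eq_abs]
      calc _ ≤ s * (8 * G * (R + s * p.1) ^ (-2 - γ)) :=
            mul_le_mul h1 hV1 (norm_nonneg _) hs.le
        _ = _ := by ring
    have hint : ∀ q : ℝ, Integrable (fun a => s * (R + s * a) ^ q)
        (volume.restrict (Icc (0 : ℝ) 1)) := fun q =>
      (hcont q).integrableOn_compact isCompact_Icc
    calc ‖U x‖ ≤ ∫ p in unitCube, g p.1 := by
          rw [hpt]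
          exact norm_integral_le_of_norm_le hgi
            ((ae_restrict_iff' measurableSet_unitCube).2 (.of_forall hbound))
      _ = 2 * B / s * (((R + s) ^ (-(1 / 2) + 1 : ℝ) - R ^ (-(1 / 2) + 1 : ℝ)) / (-(1 / 2) + 1))
          + 8 * G * (((R + s) ^ (-2 - γ + 1) - R ^ (-2 - γ + 1)) / (-2 - γ + 1)) := by
          rw [integral_unitCube_fst, integral_add ((hint _).const_mul _) ((hint _).const_mul _),
            integral_const_mul (2 * B / s), integral_const_mul (8 * G),
            integral_unitInterval_rpow hR0 hs.le (by norm_num),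
            integral_unitInterval_rpow hR0 hs.le (by intro h; linarith)]
      _ ≤ 4 * B * ((R + s) ^ (1 / 2 : ℝ) / s) + 8 * G * R ^ (-1 - γ) := by
          have e1 : (-(1 / 2) + 1 : ℝ) = 1 / 2 := by norm_num
          have e2 : -2 - γ + 1 = -1 - γ := by ring
          rw [e1, e2]
          refine add_le_add ?_ (mul_le_mul_of_nonneg_left ?_ (by positivity))
          · have hRp : 0 ≤ R ^ (1 / 2 : ℝ) := Real.rpow_nonneg hR0.le _
            calc 2 * B / s * (((R + s) ^ (1 / 2 : ℝ) - R ^ (1 / 2 : ℝ)) / (1 / 2))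
                = 4 * B / s * ((R + s) ^ (1 / 2 : ℝ) - R ^ (1 / 2 : ℝ)) := by ring
              _ ≤ 4 * B / s * (R + s) ^ (1 / 2 : ℝ) := by
                gcongr
                linarith
              _ = _ := by ring
          · have hRp : 0 ≤ R ^ (-1 - γ) := Real.rpow_nonneg hR0.le _
            have hRp' : 0 ≤ (R + s) ^ (-1 - γ) := Real.rpow_nonneg (by linarith) _
            rw [div_le_iff_of_neg (by linarith)]
            nlinarith
  have hlim : Filter.Tendsto
      (fun s : ℝ => 4 * B * ((R + s) ^ (1 / 2 : ℝ) / s) + 8 * G * R ^ (-1 - γ)) Filter.atTop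
      (nhds (4 * B * 0 + 8 * G * R ^ (-1 - γ))) := by
    refine Filter.Tendsto.add_const _ (Filter.Tendsto.const_mul _ ?_)
    have h2 : Filter.Tendsto (fun s : ℝ => 2 * s ^ (-(1 / 2) : ℝ)) Filter.atTop (nhds 0) := by
      simpa using (tendsto_rpow_neg_atTop (by norm_num : (0 : ℝ) < 1 / 2)).const_mul 2
    refine squeeze_zero' ?_ ?_ h2
    · filter_upwards [Filter.eventually_gt_atTop 0] with s hs
      positivity
    · filter_upwards [Filter.eventually_ge_atTop R] with s hs
      have hs0 : 0 < s := by linarith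
      rw [div_le_iff₀ hs0]
      calc (R + s) ^ (1 / 2 : ℝ) ≤ (4 * s) ^ (1 / 2 : ℝ) :=
            Real.rpow_le_rpow (by linarith) (by linarith) (by norm_num)
        _ = 2 * s ^ (1 / 2 : ℝ) := by
            rw [Real.mul_rpow (by norm_num) hs0.le, show (4 : ℝ) = 2 ^ (2 : ℝ) by norm_num,
              ← Real.rpow_mul (by norm_num)]
            norm_num
        _ = 2 * s ^ (-(1 / 2) : ℝ) * s := by
            rw [mul_assoc, ← Real.rpow_add_one hs0.ne']
            norm_num
  rw [mul_zero, zero_add] at hlim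
  exact ge_of_tendsto hlim (by
    filter_upwards [Filter.eventually_gt_atTop 0] with s hs
    simpa using key s hs)

end Ray

/-! ### The weight and the distance to the light cone -/

section Weight

lemma one_le_weight (γ μ q : ℝ) : 1 ≤ weight γ μ q := by
  unfold weight
  split_ifs <;> simp <;> positivity

/-- At bounded times the weight `w` dominates `(1 + |x|)^(1 + 2γ)`. -/
lemma rpow_le_sqrt_weight {γ T t : ℝ} (hγ : γ ∈ Ioo (0 : ℝ) (1 / 2)) (μ : ℝ) (ht : 0 ≤ t)
    (htT : t ≤ T) (x : Space) :
    (1 + ‖x‖) ^ (1 / 2 + γ) ≤ (1 + T) * √(weight γ μ (‖x‖ - t)) := by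
  obtain ⟨hγ0, hγ1⟩ := hγ
  have hx := norm_nonneg x
  have hT : 0 ≤ T := ht.trans htT
  have hw := one_le_weight γ μ (‖x‖ - t)
  have hT1 : (1 + T) ^ (1 / 2 + γ) ≤ 1 + T := by
    conv_rhs => rw [← Real.rpow_one (1 + T)]
    exact Real.rpow_le_rpow_of_exponent_le (by linarith) (by linarith)
  by_cases hq : 0 < ‖x‖ - t
  · have h1 : 1 + ‖x‖ ≤ (1 + T) * (1 + |‖x‖ - t|) := by
      rw [abs_of_pos hq]
      nlinarith
    have h2 : (1 + |‖x‖ - t|) ^ (1 / 2 + γ) ≤ √(weight γ μ (‖x‖ - t)) := by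
      refine Real.le_sqrt_of_sq_le ?_
      rw [weight, if_pos hq, ← Real.rpow_natCast, ← Real.rpow_mul (by positivity)]
      have : (1 / 2 + γ) * ((2 : ℕ) : ℝ) = 1 + 2 * γ := by push_cast; ring
      rw [this]
      linarith
    calc (1 + ‖x‖) ^ (1 / 2 + γ) ≤ ((1 + T) * (1 + |‖x‖ - t|)) ^ (1 / 2 + γ) := by gcongr
      _ = (1 + T) ^ (1 / 2 + γ) * (1 + |‖x‖ - t|) ^ (1 / 2 + γ) :=
        Real.mul_rpow (by positivity) (by positivity)
      _ ≤ (1 + T) * √(weight γ μ (‖x‖ - t)) := by gcongr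
  · have h2 : 1 ≤ √(weight γ μ (‖x‖ - t)) := Real.one_le_sqrt.2 hw
    calc (1 + ‖x‖) ^ (1 / 2 + γ) ≤ (1 + T) ^ (1 / 2 + γ) := by
          gcongr
          linarith
      _ ≤ (1 + T) * 1 := by linarith
      _ ≤ (1 + T) * √(weight γ μ (‖x‖ - t)) := by gcongr

lemma measurable_weight (γ μ : ℝ) : Measurable (weight γ μ) := by
  unfold weight
  refine Measurable.ite measurableSet_Ioi ?_ ?_ <;> fun_prop

/-- Outside the light cone `1 + |q|` is at most `1 + |x|`. -/
lemma rpow_le_rpow_outside {t s : ℝ} (ht : 0 ≤ t) (hs : s ≤ 0) {x : Space} (hq : 0 < ‖x‖ - t) :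
    (1 + ‖x‖) ^ s ≤ (1 + |‖x‖ - t|) ^ s := by
  refine Real.rpow_le_rpow_of_nonpos (by positivity) ?_ hs
  rw [abs_of_pos hq]
  linarith

/-- Inside the light cone `1 + |q|` is at most `1 + T`. -/
lemma rpow_le_rpow_inside {t T s s' : ℝ} (htT : t ≤ T) (hs : s ≤ 0) (hs' : s' ∈ Icc (-2 : ℝ) 0)
    {x : Space} (hq : ‖x‖ - t < 0) :
    (1 + ‖x‖) ^ s ≤ (1 + T) ^ 2 * (1 + |‖x‖ - t|) ^ s' := by
  have hx := norm_nonneg x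
  have hT : 0 ≤ T := by linarith
  have h1 : (1 + ‖x‖) ^ s ≤ 1 := Real.rpow_le_one_of_one_le_of_nonpos (by linarith) hs
  have h2 : 1 + |‖x‖ - t| ≤ 1 + T := by
    rw [abs_of_neg hq]
    linarith
  have h3 : (1 + T) ^ (-2 : ℝ) ≤ (1 + |‖x‖ - t|) ^ s' :=
    (Real.rpow_le_rpow_of_exponent_le (by linarith) hs'.1).trans
      (Real.rpow_le_rpow_of_nonpos (by positivity) h2 hs'.2)
  have h4 : (1 + T) ^ 2 * (1 + T) ^ (-2 : ℝ) = 1 := by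
    rw [Real.rpow_neg (by linarith)]
    norm_num
    exact mul_inv_cancel₀ (by positivity)
  calc (1 + ‖x‖) ^ s ≤ 1 := h1
    _ = (1 + T) ^ 2 * (1 + T) ^ (-2 : ℝ) := h4.symm
    _ ≤ _ := by gcongr

end Weight

/-! ### Decay of a single field -/

section Field

variable {W : Type} [NormedAddCommGroup W] [NormedSpace ℝ W]

lemma zJet_eq_iterL (T : ℝ) (u : ℝ → L2 W) (I : List VF) (t : ℝ) :
    zJet T u I t = iterL t I (jetAt T u t) := (iterL_apply t I _).symm

/-- The sum of the norms of `∂ Z^J Z^I u` over all `J` with `|J| ≤ 3`. -/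
def gradSum (T : ℝ) (u : ℝ → L2 W) (I : List VF) (t : ℝ) (x : Space) : ℝ :=
  ∑ k ∈ Finset.range 4, ∑ J : Fin k → VF, ‖zGrad T u (List.ofFn J ++ I) t x‖

lemma gradSum_nonneg (T : ℝ) (u : ℝ → L2 W) (I : List VF) (t : ℝ) (x : Space) :
    0 ≤ gradSum T u I t x :=
  Finset.sum_nonneg fun _ _ => Finset.sum_nonneg fun _ _ => norm_nonneg _

lemma gradBound_gradSum (T : ℝ) (u : ℝ → L2 W) (I : List VF) (t : ℝ) (x : Space) :
    GradBound t x 3 (zJet T u I t) (gradSum T u I t x) := by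
  intro J hJ α
  have h1 : ‖iterL t J (zJet T u I t) (Pi.single α 1) x‖
      ≤ ‖zGrad T u (List.ofFn J.get ++ I) t x‖ := by
    rw [List.ofFn_get, zJet_eq_iterL, ← iterL_append, ← zJet_eq_iterL]
    exact PiLp.norm_apply_le (zGrad T u (J ++ I) t x) α
  refine h1.trans (le_trans ?_ (Finset.single_le_sum
    (f := fun k => ∑ J : Fin k → VF, ‖zGrad T u (List.ofFn J ++ I) t x‖)
    (fun _ _ => Finset.sum_nonneg fun _ _ => norm_nonneg _)
    (Finset.mem_range.2 (Nat.lt_succ_of_le hJ))))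
  exact Finset.single_le_sum (f := fun J : Fin J.length → VF =>
    ‖zGrad T u (List.ofFn J ++ I) t x‖) (fun _ _ => norm_nonneg _) (Finset.mem_univ _)

lemma MemE.regular_zJet [CompleteSpace W] {N m : ℕ} {T : ℝ} {u : ℝ → L2 W} (hu : MemE (N + 1) T u)
    {t : ℝ} (ht : t ∈ Ico 0 T) {I : List VF} (hI : m + I.length ≤ N + 1) :
    (zJet T u I t).Regular m := by
  rw [zJet_eq_iterL]
  exact Jet.Regular.iterL t I ((hu.regular_jetAt ht).mono hI)

/-- All derivatives of a field at a fixed time are measurable, also beyond the order of its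
regularity. -/
lemma stronglyMeasurable_zJet (T : ℝ) (u : ℝ → L2 W) (I : List VF) (t : ℝ) (a : Fin 4 → ℕ) :
    StronglyMeasurable (zJet T u I t a) := by
  have key : ∀ (v : Jet W) (Z : VF), (∀ a, StronglyMeasurable (v a)) →
      ∀ a, StronglyMeasurable (Z.act t v a) := by
    intro v Z hv
    have hm : ∀ α β a, StronglyMeasurable ((v.partial β).mulCoord t α a) := fun α β a =>
      ((continuous_coord t α).stronglyMeasurable.smul (hv _)).add ((hv _).const_smul _)
    cases Z with
    | d α => exact fun a => hv _
    | Ω α β => exact fun a => ((hm α β a).const_smul _).neg.add ((hm β α a).const_smul _)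
    | S =>
      intro a
      simp only [VF.act, Fin.sum_univ_four]
      exact (((hm 0 0 a).add (hm 1 1 a)).add (hm 2 2 a)).add (hm 3 3 a)
  unfold zJet
  induction I generalizing a with
  | nil => exact Lp.stronglyMeasurable _
  | cons Z I ih => exact key _ Z ih a

lemma stronglyMeasurable_sqrt_weight (γ μ t : ℝ) :
    StronglyMeasurable fun x : Space => √(weight γ μ (‖x‖ - t)) :=
  ((measurable_weight γ μ).comp (measurable_norm.sub_const t)).sqrt.stronglyMeasurable

lemma stronglyMeasurable_zGrad (T : ℝ) (u : ℝ → L2 W) (I : List VF) (t : ℝ) :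
    StronglyMeasurable (zGrad T u I t) := by
  have e : zGrad T u I t = fun x => ∑ α : Fin 4,
      (WithLp.toLp 2 (Pi.single α (zJet T u I t (Pi.single α 1) x)) : Grad W) := by
    funext x
    ext β
    simp [zGrad, Pi.single_apply]
  rw [e]
  exact Finset.stronglyMeasurable_fun_sum _ fun α _ =>
    ((PiLp.continuous_toLp 2 (fun _ : Fin 4 => W)).comp
      (continuous_single α)).comp_stronglyMeasurable (stronglyMeasurable_zJet T u I t _)

lemma norm_le_sum_components (G : Grad W) : ‖G‖ ≤ ∑ α, ‖G α‖ := by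
  rw [PiLp.norm_eq_of_L2, Real.sqrt_le_left (Finset.sum_nonneg fun _ _ => norm_nonneg _)]
  exact Finset.sum_sq_le_sq_sum_of_nonneg fun _ _ => norm_nonneg _

lemma stronglyMeasurable_weighted_gradSum (γ μ T : ℝ) (u : ℝ → L2 W) (I : List VF) (t : ℝ) :
    StronglyMeasurable fun x : Space => √(weight γ μ (‖x‖ - t)) * gradSum T u I t x := by
  refine (stronglyMeasurable_sqrt_weight γ μ t).mul ?_
  unfold gradSum
  exact Finset.stronglyMeasurable_fun_sum _ fun k _ =>
    Finset.stronglyMeasurable_fun_sum _ fun J _ => (stronglyMeasurable_zGrad T u _ t).norm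

/-- The number of products of at most three fields. -/
@[irreducible] def wordCount : ℕ := ∑ k ∈ Finset.range 4, Fintype.card (Fin k → VF)

lemma eLpNorm_weighted_gradSum_le {N : ℕ} {γ μ T E : ℝ} {u : ℝ → L2 W} {t : ℝ}
    (hE : ∀ J : List VF, J.length ≤ N → weightedNorm γ μ T u J t ≤ ENNReal.ofReal E) {I : List VF}
    (hI : I.length + 3 ≤ N) :
    eLpNorm (fun x : Space => √(weight γ μ (‖x‖ - t)) * gradSum T u I t x) 2 volume
      ≤ ENNReal.ofReal (wordCount * E) := by
  have hmeas : ∀ J : List VF, StronglyMeasurable fun x : Space =>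
      ‖√(weight γ μ (‖x‖ - t)) • zGrad T u J t x‖ := fun J =>
    ((stronglyMeasurable_sqrt_weight γ μ t).smul (stronglyMeasurable_zGrad T u J t)).norm
  have e : (fun x : Space => √(weight γ μ (‖x‖ - t)) * gradSum T u I t x)
      = ∑ k ∈ Finset.range 4, ∑ J : Fin k → VF,
        fun x : Space => ‖√(weight γ μ (‖x‖ - t)) • zGrad T u (List.ofFn J ++ I) t x‖ := by
    funext x
    simp only [gradSum, Finset.mul_sum, Finset.sum_apply, norm_smul, Real.norm_eq_abs,
      abs_of_nonneg (Real.sqrt_nonneg _)]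
  have hle : eLpNorm (fun x : Space => √(weight γ μ (‖x‖ - t)) * gradSum T u I t x) 2 volume
      ≤ ∑ k ∈ Finset.range 4, ∑ J : Fin k → VF, ENNReal.ofReal E := by
    rw [e]
    refine (eLpNorm_sum_le (fun k _ => (Finset.stronglyMeasurable_sum _
      fun J _ => hmeas _).aestronglyMeasurable) (by norm_num)).trans
      (Finset.sum_le_sum fun k hk => ?_)
    refine (eLpNorm_sum_le (fun J _ => (hmeas _).aestronglyMeasurable) (by norm_num)).trans
      (Finset.sum_le_sum fun J _ => ?_)
    rw [eLpNorm_norm]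
    refine hE _ ?_
    have := Finset.mem_range.1 hk
    simp only [List.length_append, List.length_ofFn]
    omega
  refine hle.trans (le_of_eq ?_)
  simp only [Finset.sum_const, Finset.card_univ, nsmul_eq_mul, ← Finset.sum_mul]
  have := ENNReal.ofReal_mul (p := (wordCount : ℝ)) (q := E) (Nat.cast_nonneg _)
  rw [this, ENNReal.ofReal_natCast]
  unfold wordCount
  rw [Nat.cast_sum]

/-- The constant of the pointwise algebraic estimate. -/
def algConst (T : ℝ) : ℝ := (9 ^ 3 * (3 * T + 12)) ^ 3 * (1 + T)

/-- The constant of the estimate for the gradient. -/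
def gradConst (γ T : ℝ) : ℝ := 64 * 2 ^ |1 / 2 + γ| * (algConst T * wordCount)

lemma algConst_pos {T : ℝ} (hT : 0 ≤ T) : 0 < algConst T := by
  unfold algConst
  positivity

lemma wordCount_pos : 0 < wordCount := by
  have h : Fintype.card (Fin 0 → VF) ≤ wordCount := by
    unfold wordCount
    exact Finset.single_le_sum (f := fun k => Fintype.card (Fin k → VF)) (fun _ _ => Nat.zero_le _)
      (Finset.mem_range.2 (by norm_num))
  have h1 : 0 < Fintype.card (Fin 0 → VF) := Fintype.card_pos
  omega

lemma gradConst_pos (γ : ℝ) {T : ℝ} (hT : 0 ≤ T) : 0 < gradConst γ T := by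
  have h1 := algConst_pos hT
  have h2 : (0 : ℝ) < wordCount := by exact_mod_cast wordCount_pos
  unfold gradConst
  positivity

/-- The spacetime multi-index of `∂₁^i ∂₂^j ∂₃^k`. -/
def spatialIndex (i j k : ℕ) : Fin 4 → ℕ := ![0, i, j, k]

lemma sum_spatialIndex (i j k : ℕ) : ∑ γ, spatialIndex i j k γ = i + j + k := by
  simp [spatialIndex, Fin.sum_univ_four]

lemma spatialIndex_succ_fst (i j k : ℕ) :
    spatialIndex (i + 1) j k = spatialIndex i j k + Pi.single (Fin.succ 0) 1 := by
  ext l; fin_cases l <;> simp [spatialIndex]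

lemma spatialIndex_succ_snd (i j k : ℕ) :
    spatialIndex i (j + 1) k = spatialIndex i j k + Pi.single (Fin.succ 1) 1 := by
  ext l; fin_cases l <;> simp [spatialIndex]

lemma spatialIndex_succ_trd (i j k : ℕ) :
    spatialIndex i j (k + 1) = spatialIndex i j k + Pi.single (Fin.succ 2) 1 := by
  ext l; fin_cases l <;> simp [spatialIndex]

lemma fin_two_sum_le (i j k : Fin 2) : (i : ℕ) + j + k ≤ 3 := by omega

/-- The derivatives of `∂ Z^I u` in terms of the density of the energy. -/
lemma weighted_norm_le {γ T t : ℝ} (hγ : γ ∈ Ioo (0 : ℝ) (1 / 2)) (μ : ℝ) (ht : 0 ≤ t)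
    (htT : t ≤ T) (u : ℝ → L2 W) (I : List VF) (α : Fin 4) (c : Fin 4 → ℕ) {n : ℕ}
    (hc : ∑ β, c β = n) (hn : n ≤ 3) (x : Space) :
    (1 + ‖x‖) ^ ((n : ℝ) + (1 / 2 + γ)) * ‖zJet T u I t (Pi.single α 1 + c) x‖
      ≤ algConst T * (√(weight γ μ (‖x‖ - t)) * gradSum T u I t x) := by
  have hx : 0 < 1 + ‖x‖ := by positivity
  have hT : 0 ≤ T := ht.trans htT
  have h1 := ((gradBound_gradSum T u I t x).mono hn).norm_deriv_le ht htT hn α c hc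
  have h2 := rpow_le_sqrt_weight hγ μ ht htT x
  have h3 := gradSum_nonneg T u I t x
  have h4 : (9 ^ 3 * (3 * T + 12)) ^ n ≤ (9 ^ 3 * (3 * T + 12)) ^ 3 :=
    pow_le_pow_right₀ (by linarith) hn
  calc (1 + ‖x‖) ^ ((n : ℝ) + (1 / 2 + γ)) * ‖zJet T u I t (Pi.single α 1 + c) x‖
      = (1 + ‖x‖) ^ (1 / 2 + γ) * ((1 + ‖x‖) ^ n * ‖zJet T u I t (Pi.single α 1 + c) x‖) := by
        rw [Real.rpow_add hx, Real.rpow_natCast]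
        ring
    _ ≤ ((1 + T) * √(weight γ μ (‖x‖ - t)))
        * ((9 ^ 3 * (3 * T + 12)) ^ 3 * gradSum T u I t x) :=
        mul_le_mul h2 (h1.trans (mul_le_mul_of_nonneg_right h4 h3)) (by positivity) (by positivity)
    _ = algConst T * (√(weight γ μ (‖x‖ - t)) * gradSum T u I t x) := by
        unfold algConst
        ring

/-- The weighted Sobolev inequality applied to `∂_α Z^I u`: here the three derivatives that
`|I| ≤ N - 3` leaves are spent. -/
lemma exists_contVersion_partial [CompleteSpace W] {N : ℕ} {γ μ T E : ℝ}
    (hγ : γ ∈ Ioo (0 : ℝ) (1 / 2)) (hE0 : 0 ≤ E) {u : ℝ → L2 W} (hu : MemE (N + 1) T u) {t : ℝ}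
    (ht : t ∈ Ico 0 T)
    (hE : ∀ J : List VF, J.length ≤ N → weightedNorm γ μ T u J t ≤ ENNReal.ofReal E) {I : List VF}
    (hI : I.length + 3 ≤ N) (α : Fin 4) :
    ∃ F : Space → W, IsContVersion F (zJet T u I t (Pi.single α 1)) ∧
      ∀ x, ‖F x‖ ≤ gradConst γ T * E * (1 + ‖x‖) ^ (-2 - γ) := by
  have hT : 0 ≤ T := ht.1.trans ht.2.le
  have hreg : (zJet T u I t).Regular 4 := hu.regular_zJet ht (by omega)
  set f : Fin 2 → Fin 2 → Fin 2 → Space → W := fun i j k =>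
    zJet T u I t (Pi.single α 1 + spatialIndex i j k)
  set m : Space → ℝ := fun x => algConst T * (√(weight γ μ (‖x‖ - t)) * gradSum T u I t x)
  have hmm : StronglyMeasurable m :=
    (stronglyMeasurable_weighted_gradSum γ μ T u I t).const_mul _
  have hmA : eLpNorm m 2 volume ≤ ENNReal.ofReal (algConst T * (wordCount * E)) := by
    have h1 := eLpNorm_const_smul_le (c := algConst T) (p := 2) (μ := (volume : Measure Space))
      (f := fun x => √(weight γ μ (‖x‖ - t)) * gradSum T u I t x)
    refine h1.trans ?_
    rw [ENNReal.ofReal_mul (algConst_pos hT).le, Real.enorm_eq_ofReal (algConst_pos hT).le]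
    gcongr
    exact eLpNorm_weighted_gradSum_le hE hI
  have hfm : ∀ (i j k : Fin 2) x,
      (1 + ‖x‖) ^ (((i : ℕ) + j + k : ℕ) + (1 / 2 + γ)) * ‖f i j k x‖ ≤ m x := fun i j k x =>
    weighted_norm_le hγ μ ht.1 ht.2.le u I α _ (sum_spatialIndex i j k) (fin_two_sum_le i j k) x
  have hf : ∀ i j k, MemLp (f i j k) 2 volume := by
    intro i j k
    refine MemLp.mono' ⟨hmm.aestronglyMeasurable, hmA.trans_lt ENNReal.ofReal_lt_top⟩
      (hreg.1 _).aestronglyMeasurable (.of_forall fun x => le_trans ?_ (hfm i j k x))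
    refine le_mul_of_one_le_left (norm_nonneg _) (Real.one_le_rpow (by simp) ?_)
    have := hγ.1
    positivity
  have hsum : ∀ i j k : ℕ,
      ∑ γ, (Pi.single α 1 + spatialIndex i j k : Fin 4 → ℕ) γ = 1 + (i + j + k) := by
    intro i j k
    simp only [Pi.add_apply, Finset.sum_add_distrib, sum_spatialIndex, Finset.sum_pi_single',
      Finset.mem_univ, if_true]
  obtain ⟨F, hF, hFb⟩ := exists_contVersion_of_weighted (σ := 1 / 2 + γ)
    (A := algConst T * (wordCount * E)) (by have := algConst_pos hT; positivity) f
    (fun i j k => hreg.1 _) hf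
    (fun j k => by
      have := hreg.3 (Pi.single α 1 + spatialIndex 0 j k) 0 (by rw [hsum]; omega)
      rwa [add_assoc, ← spatialIndex_succ_fst] at this)
    (fun i k => by
      have := hreg.3 (Pi.single α 1 + spatialIndex i 0 k) 1 (by rw [hsum]; omega)
      rwa [add_assoc, ← spatialIndex_succ_snd] at this)
    (fun i j => by
      have := hreg.3 (Pi.single α 1 + spatialIndex i j 0) 2 (by rw [hsum]; omega)
      rwa [add_assoc, ← spatialIndex_succ_trd] at this)
    m hmm hmA hfm
  have h0 : f 0 0 0 = zJet T u I t (Pi.single α 1) := by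
    have : spatialIndex 0 0 0 = 0 := by
      ext l; fin_cases l <;> simp [spatialIndex]
    change zJet T u I t (Pi.single α 1 + spatialIndex 0 0 0) = _
    rw [this, add_zero]
  refine ⟨F, h0 ▸ hF, fun x => (hFb x).trans (le_of_eq ?_)⟩
  rw [show -(1 / 2 + γ) - 3 / 2 = -2 - γ by ring]
  unfold gradConst
  ring

/-- The field itself tends to zero at infinity, with a constant that the energy does not control. -/
lemma exists_contVersion_undifferentiated [CompleteSpace W] {N : ℕ} (hN : 3 ≤ N) {γ μ T E : ℝ}
    (hγ : γ ∈ Ioo (0 : ℝ) (1 / 2)) {u : ℝ → L2 W} (hu : MemE (N + 1) T u) {t : ℝ}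
    (ht : t ∈ Ico 0 T)
    (hE : ∀ J : List VF, J.length ≤ N → weightedNorm γ μ T u J t ≤ ENNReal.ofReal E) :
    ∃ (F : Space → W) (B : ℝ), IsContVersion F (jetAt T u t 0) ∧
      ∀ x, ‖F x‖ ≤ B * (1 + ‖x‖) ^ (-1 : ℝ) := by
  have hT : 0 ≤ T := ht.1.trans ht.2.le
  have hreg : (jetAt T u t).Regular 4 := (hu.regular_jetAt ht).mono (by omega)
  set f : Fin 2 → Fin 2 → Fin 2 → Space → W := fun i j k => jetAt T u t (spatialIndex i j k)
  set m₁ : Space → ℝ := fun x => algConst T * (√(weight γ μ (‖x‖ - t)) * gradSum T u [] t x)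
  set m : Space → ℝ := fun x => ‖jetAt T u t 0 x‖ + m₁ x
  have hmm₁ : StronglyMeasurable m₁ :=
    (stronglyMeasurable_weighted_gradSum γ μ T u [] t).const_mul _
  have hm₁ : MemLp m₁ 2 volume := by
    refine MemLp.const_mul ⟨(stronglyMeasurable_weighted_gradSum γ μ T u [] t).aestronglyMeasurable,
      ?_⟩ _
    exact (eLpNorm_weighted_gradSum_le hE (by simpa using hN)).trans_lt ENNReal.ofReal_lt_top
  have hm : MemLp m 2 volume := (Lp.memLp _).norm.add hm₁
  have hmm : StronglyMeasurable m := (hreg.1 0).norm.add hmm₁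
  have hm₁0 : ∀ x, 0 ≤ m₁ x := fun x =>
    mul_nonneg (algConst_pos hT).le (mul_nonneg (Real.sqrt_nonneg _) (gradSum_nonneg _ _ _ _ _))
  have hfm : ∀ (i j k : Fin 2) x,
      (1 + ‖x‖) ^ (((i : ℕ) + j + k : ℕ) + (-(1 / 2) : ℝ)) * ‖f i j k x‖ ≤ m x := by
    intro i j k x
    have hx : 1 ≤ 1 + ‖x‖ := by simp
    by_cases h0 : (i : ℕ) + j + k = 0
    · have hidx : spatialIndex i j k = 0 := by
        have hi : (i : ℕ) = 0 := by omega
        have hj : (j : ℕ) = 0 := by omega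
        have hk : (k : ℕ) = 0 := by omega
        ext l; fin_cases l <;> simp [spatialIndex, hi, hj, hk]
      simp only [h0, f, hidx, Nat.cast_zero, zero_add]
      refine le_trans (mul_le_of_le_one_left (norm_nonneg _)
        (Real.rpow_le_one_of_one_le_of_nonpos hx (by norm_num))) ?_
      exact le_add_of_nonneg_right (hm₁0 x)
    · -- one derivative is split off, and the remaining ones act on the gradient
      obtain ⟨β, c, hc, hcn⟩ : ∃ (β : Fin 4) (c : Fin 4 → ℕ),
          spatialIndex i j k = Pi.single β 1 + c ∧ ∑ γ, c γ + 1 = (i : ℕ) + j + k := by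
        obtain ⟨β, hβ⟩ : ∃ β, spatialIndex i j k β ≠ 0 := by
          by_contra hcon
          push Not at hcon
          rw [← sum_spatialIndex] at h0
          exact h0 (Finset.sum_eq_zero fun β _ => hcon β)
        have hsp : spatialIndex i j k = Pi.single β 1 + (spatialIndex i j k - Pi.single β 1) := by
          funext γ
          by_cases hγ : γ = β
          · subst hγ
            simp
            omega
          · simp [hγ]
        refine ⟨β, _, hsp, ?_⟩
        have h1 := congrArg (fun c : Fin 4 → ℕ => ∑ γ, c γ) hsp
        simp only [sum_spatialIndex] at h1
        rw [h1]
        simp only [Pi.add_apply, Finset.sum_add_distrib, Finset.sum_pi_single', Finset.mem_univ,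
          if_true]
        exact add_comm _ _
      have h3 := fin_two_sum_le i j k
      have h1 := weighted_norm_le hγ μ ht.1 ht.2.le u [] β c rfl (by omega) x
      rw [← hc] at h1
      change _ * ‖f i j k x‖ ≤ m₁ x at h1
      have h2 : (1 + ‖x‖) ^ (((i : ℕ) + j + k : ℕ) + (-(1 / 2) : ℝ))
          ≤ (1 + ‖x‖) ^ (((∑ γ, c γ : ℕ) : ℝ) + (1 / 2 + γ)) := by
        refine Real.rpow_le_rpow_of_exponent_le hx ?_
        rw [← hcn]
        push_cast
        have := hγ.1
        linarith
      calc _ ≤ (1 + ‖x‖) ^ (((∑ γ, c γ : ℕ) : ℝ) + (1 / 2 + γ)) * ‖f i j k x‖ := by gcongr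
        _ ≤ m₁ x := h1
        _ ≤ m x := le_add_of_nonneg_left (norm_nonneg _)
  obtain ⟨F, hF, hFb⟩ := exists_contVersion_of_weighted (σ := -(1 / 2))
    (A := (eLpNorm m 2 volume).toReal) ENNReal.toReal_nonneg f
    (fun i j k => hreg.1 _) (fun i j k => Lp.memLp _)
    (fun j k => by
      have := hreg.3 (spatialIndex 0 j k) 0 (by rw [sum_spatialIndex]; omega)
      rwa [← spatialIndex_succ_fst] at this)
    (fun i k => by
      have := hreg.3 (spatialIndex i 0 k) 1 (by rw [sum_spatialIndex]; omega)
      rwa [← spatialIndex_succ_snd] at this)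
    (fun i j => by
      have := hreg.3 (spatialIndex i j 0) 2 (by rw [sum_spatialIndex]; omega)
      rwa [← spatialIndex_succ_trd] at this)
    m hmm (by rw [ENNReal.ofReal_toReal hm.2.ne]) hfm
  have h0 : f 0 0 0 = jetAt T u t 0 := by
    have : spatialIndex 0 0 0 = 0 := by
      ext l; fin_cases l <;> simp [spatialIndex]
    change jetAt T u t (spatialIndex 0 0 0) = _
    rw [this]
  refine ⟨F, 64 * 2 ^ |(-(1 / 2) : ℝ)| * (eLpNorm m 2 volume).toReal, h0 ▸ hF,
    fun x => (hFb x).trans (le_of_eq ?_)⟩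
  norm_num

/-- A field of `𝔏` is a combination of the translations, with coefficients of size `1 + |x|`. -/
lemma VF.exists_act_zero_eq (Z : VF) {t T : ℝ} (ht : 0 ≤ t) (htT : t ≤ T) :
    ∃ c : Fin 4 → Space → ℝ, (∀ γ, Continuous (c γ)) ∧
      (∀ γ x, |c γ x| ≤ 2 * (1 + T) * (1 + ‖x‖)) ∧
      ∀ (v : Jet W) x, Z.act t v 0 x = ∑ γ, c γ x • v (Pi.single γ 1) x := by
  have hT : 0 ≤ T := ht.trans htT
  have hm : ∀ α, |mink α| ≤ 1 := by
    intro α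
    refine Fin.cases ?_ (fun i => ?_) α <;> simp [mink]
  have hcoord : ∀ (α : Fin 4) (x : Space), |coord t x α| ≤ (1 + T) * (1 + ‖x‖) := by
    intro α x
    have hx := norm_nonneg x
    refine Fin.cases ?_ (fun i => ?_) α
    · simp only [coord, Fin.cons_zero]
      rw [abs_of_nonneg ht]
      nlinarith
    · simp only [coord, Fin.cons_succ]
      refine (abs_coord_le_norm x i).trans ?_
      nlinarith
  have hmc : ∀ α β (x : Space), |mink α * coord t x β| ≤ (1 + T) * (1 + ‖x‖) := by
    intro α β x
    rw [abs_mul]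
    exact (mul_le_of_le_one_left (abs_nonneg _) (hm α)).trans (hcoord β x)
  have hR : ∀ x : Space, 1 ≤ (1 + T) * (1 + ‖x‖) := by
    intro x
    have hx := norm_nonneg x
    nlinarith
  have hmul : ∀ α β (v : Jet W) x,
      (v.partial β).mulCoord t α 0 x = coord t x α • v (Pi.single β 1) x := by
    intro α β v x
    simp [Jet.mulCoord, Jet.partial]
  cases Z with
  | d α =>
    refine ⟨fun γ _ => if γ = α then 1 else 0, fun γ => continuous_const, fun γ x => ?_,
      fun v x => ?_⟩
    · have := hR x
      dsimp only
      split_ifs <;> simp <;> linarith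
    · simp [VF.act, Jet.partial]
  | Ω α β =>
    refine ⟨fun γ x => -(if γ = β then mink α * coord t x α else 0)
      + (if γ = α then mink β * coord t x β else 0), fun γ => ?_, fun γ x => ?_, fun v x => ?_⟩
    · have h1 := continuous_coord t α
      have h2 := continuous_coord t β
      dsimp only
      split_ifs <;> fun_prop
    · refine (abs_add_le _ _).trans ?_
      have h1 := hmc α α x
      have h2 := hmc β β x
      have h3 := hR x
      have h4 : ∀ (P : Prop) [Decidable P] (a : ℝ), |if P then a else 0| ≤ |a| := by
        intro P _ a
        split_ifs <;> simp
      rw [abs_neg]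
      linarith [h4 (γ = β) (mink α * coord t x α), h4 (γ = α) (mink β * coord t x β)]
    · simp only [VF.act, Pi.add_apply, Pi.neg_apply, Pi.smul_apply, hmul, add_smul, neg_smul,
        ite_smul, zero_smul, Finset.sum_add_distrib, Finset.sum_neg_distrib, Finset.sum_ite_eq',
        Finset.mem_univ, if_true, mul_smul]
  | S =>
    refine ⟨fun γ x => coord t x γ, fun γ => continuous_coord t γ, fun γ x => ?_, fun v x => ?_⟩
    · have h1 := hcoord γ x
      have h2 := hR x
      linarith
    · simp only [VF.act, Finset.sum_apply, hmul]

/-- The decay of a single field, in terms of `1 + |x|`. -/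
theorem exists_contVersions [CompleteSpace W] {N : ℕ} {γ μ T E : ℝ}
    (hγ : γ ∈ Ioo (0 : ℝ) (1 / 2)) (hE0 : 0 ≤ E) {u : ℝ → L2 W} (hu : MemE (N + 1) T u) {t : ℝ}
    (ht : t ∈ Ico 0 T)
    (hE : ∀ J : List VF, J.length ≤ N → weightedNorm γ μ T u J t ≤ ENNReal.ofReal E) {I : List VF}
    (hI : I.length + 3 ≤ N) :
    ∃ (z : Space → W) (d : Space → Grad W),
      IsContVersion z (zField T u I t) ∧ IsContVersion d (zGrad T u I t) ∧
      (∀ x, ‖d x‖ ≤ 4 * gradConst γ T * E * (1 + ‖x‖) ^ (-2 - γ)) ∧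
      ∀ x, ‖z x‖ ≤ 8 * (1 + T) * gradConst γ T * E * (1 + ‖x‖) ^ (-1 - γ) := by
  have hT : 0 ≤ T := ht.1.trans ht.2.le
  have hK := gradConst_pos γ hT
  have hd : ∀ J : List VF, J.length + 3 ≤ N → ∃ F : Fin 4 → Space → W,
      (∀ α, IsContVersion (F α) (zJet T u J t (Pi.single α 1))) ∧
        ∀ α x, ‖F α x‖ ≤ gradConst γ T * E * (1 + ‖x‖) ^ (-2 - γ) := by
    intro J hJ
    choose F hF hFb using fun α => exists_contVersion_partial hγ hE0 hu ht hE hJ α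
    exact ⟨F, hF, hFb⟩
  have hz : ∃ z : Space → W, IsContVersion z (zField T u I t) ∧
      ∀ x, ‖z x‖ ≤ 8 * (1 + T) * gradConst γ T * E * (1 + ‖x‖) ^ (-1 - γ) := by
    cases I with
    | nil =>
      obtain ⟨U, B, hU, hUB⟩ :=
        exists_contVersion_undifferentiated (by simpa using hI) hγ hu ht hE
      obtain ⟨F, hF, hFb⟩ := hd [] hI
      have hw : HasWeakPartial 0 U (F (Fin.succ 0)) := by
        have h1 := (hu.regular_jetAt ht).3 0 0 (by simp)
        rw [zero_add] at h1
        exact h1.congr_ae hU.2.symm (hF (Fin.succ 0)).2.symm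
      refine ⟨U, hU, fun x => ?_⟩
      refine (norm_le_of_weakPartial_decay hU.1 (hF _).1 hw hγ.1 (by linarith [hγ.2])
        (by positivity) hUB (hFb _) x).trans ?_
      have h1 : 0 ≤ gradConst γ T * E * (1 + ‖x‖) ^ (-1 - γ) := by positivity
      nlinarith
    | cons Z I =>
      obtain ⟨F, hF, hFb⟩ := hd I (by simp only [List.length_cons] at hI; omega)
      obtain ⟨c, hc, hcb, hZ⟩ := Z.exists_act_zero_eq (W := W) ht.1 ht.2.le
      refine ⟨fun x => ∑ γ, c γ x • F γ x,
        ⟨continuous_finsetSum _ fun γ _ => (hc γ).smul (hF γ).1, ?_⟩, fun x => ?_⟩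
      · filter_upwards [ae_all_iff.2 fun γ => (hF γ).2] with x hx
        change _ = Z.act t (zJet T u I t) 0 x
        simp only [hZ, hx]
      · have hx : 0 < 1 + ‖x‖ := by positivity
        have hterm : ∀ β ∈ Finset.univ, ‖c β x • F β x‖
            ≤ 2 * (1 + T) * (1 + ‖x‖) * (gradConst γ T * E * (1 + ‖x‖) ^ (-2 - γ)) := by
          intro β _
          rw [norm_smul, Real.norm_eq_abs]
          exact mul_le_mul (hcb β x) (hFb β x) (norm_nonneg _) (by positivity)
        refine (norm_sum_le_of_le _ hterm).trans (le_of_eq ?_)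
        rw [show -1 - γ = -2 - γ + 1 by ring, Real.rpow_add_one hx.ne']
        simp
        ring
  obtain ⟨z, hzc, hzb⟩ := hz
  obtain ⟨F, hF, hFb⟩ := hd I hI
  refine ⟨z, fun x => WithLp.toLp 2 (fun α => F α x), hzc, ⟨?_, ?_⟩, fun x => ?_, hzb⟩
  · exact (PiLp.continuous_toLp 2 (fun _ : Fin 4 => W)).comp (continuous_pi fun α => (hF α).1)
  · filter_upwards [ae_all_iff.2 fun α => (hF α).2] with x hx
    simp only [zGrad, hx]
  · refine (norm_le_sum_components _).trans ?_
    refine (Finset.sum_le_sum fun α _ => hFb α x).trans (le_of_eq ?_)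
    simp
    ring

lemma norm_tangential_le (x : Space) (G : Grad W) : ‖tangential x G‖ ≤ 16 * ‖G‖ := by
  have hω : ∀ j, |x j / ‖x‖| ≤ 1 := by
    intro j
    rw [abs_div, abs_norm]
    exact div_le_one_of_le₀ (abs_coord_le_norm x j) (norm_nonneg _)
  have hG : ∀ α, ‖G α‖ ≤ ‖G‖ := fun α => PiLp.norm_apply_le G α
  have hrad : ‖radial x G‖ ≤ 3 * ‖G‖ := by
    unfold radial
    have hterm : ∀ j ∈ Finset.univ, ‖(x j / ‖x‖) • G j.succ‖ ≤ ‖G‖ := by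
      intro j _
      rw [norm_smul, Real.norm_eq_abs]
      exact (mul_le_of_le_one_left (norm_nonneg _) (hω j)).trans (hG _)
    refine (norm_sum_le_of_le _ hterm).trans (le_of_eq ?_)
    simp
  have hcomp : ∀ α, ‖tangential x G α‖ ≤ 4 * ‖G‖ := by
    intro α
    refine Fin.cases ?_ (fun i => ?_) α
    · change ‖G 0 + radial x G‖ ≤ _
      refine (norm_add_le _ _).trans ?_
      linarith [hG 0]
    · change ‖G i.succ - (x i / ‖x‖) • radial x G‖ ≤ _
      refine (norm_sub_le _ _).trans ?_
      rw [norm_smul, Real.norm_eq_abs]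
      have := mul_le_of_le_one_left (norm_nonneg (radial x G)) (hω i)
      linarith [hG i.succ]
  refine (norm_le_sum_components _).trans
    ((Finset.sum_le_sum fun α _ => hcomp α).trans (le_of_eq ?_))
  simp
  ring

end Field

/-! ### The three fields together -/

section Energy

lemma weightedNorm_add_le_energy {N : ℕ} (γ μ T : ℝ) (h : ℝ → L2 Tensor2) (A : ℝ → L2 GaugeForm)
    (Φ : ℝ → L2 Higgs) (t : ℝ) {J : List VF} (hJ : J.length ≤ N) :
    weightedNorm γ μ T h J t + weightedNorm γ μ T A J t + weightedNorm γ μ T Φ J t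
      ≤ energy N γ μ T h A Φ t := by
  conv_lhs => rw [← List.ofFn_get J]
  refine le_trans ?_ (Finset.single_le_sum (f := fun k => ∑ I : Fin k → VF,
    (weightedNorm γ μ T h (List.ofFn I) t + weightedNorm γ μ T A (List.ofFn I) t +
      weightedNorm γ μ T Φ (List.ofFn I) t)) (fun _ _ => zero_le)
    (Finset.mem_range.2 (Nat.lt_succ_of_le hJ)))
  exact Finset.single_le_sum (f := fun I : Fin J.length → VF =>
    (weightedNorm γ μ T h (List.ofFn I) t + weightedNorm γ μ T A (List.ofFn I) t +
      weightedNorm γ μ T Φ (List.ofFn I) t)) (fun _ _ => zero_le) (Finset.mem_univ _)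

/-- The constant of the final estimate: the three fields, the passage from `1 + |x|` to `1 + |q|`,
and the passage to tangential derivatives each contribute a factor. -/
def decayConst (γ T C : ℝ) : ℝ := 48 * (8 * (1 + T) * gradConst γ T) * (2 * C) * (1 + T) ^ 2

lemma decayConst_pos (γ : ℝ) {T C : ℝ} (hT : 0 ≤ T) (hC : 0 < C) : 0 < decayConst γ T C := by
  have := gradConst_pos γ hT
  unfold decayConst
  positivity

/-- Decay in `1 + |x|` of three quantities, rewritten as decay of their sum in `1 + |q|`. -/
lemma decay_in_q {γ T C ε t a b c κ s s' : ℝ} (hT : 0 ≤ T) (hC : 0 < C) (hε : 0 < ε) (ht : 0 ≤ t)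
    (htT : t ≤ T) (hs : s ≤ 0) (hs' : s' ∈ Icc (-2 : ℝ) 0)
    (hκ : κ ≤ 16 * (8 * (1 + T) * gradConst γ T)) {x : Space}
    (ha : a ≤ κ * (2 * C * ε) * (1 + ‖x‖) ^ s) (hb : b ≤ κ * (2 * C * ε) * (1 + ‖x‖) ^ s)
    (hc : c ≤ κ * (2 * C * ε) * (1 + ‖x‖) ^ s) :
    (0 < ‖x‖ - t → a + b + c ≤ decayConst γ T C * ε * (1 + |‖x‖ - t|) ^ s) ∧
      (‖x‖ - t < 0 → a + b + c ≤ decayConst γ T C * ε * (1 + |‖x‖ - t|) ^ s') := by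
  have hT1 : (1 : ℝ) ≤ (1 + T) ^ 2 := one_le_pow₀ (by linarith)
  have hK := gradConst_pos γ hT
  set P := 48 * (8 * (1 + T) * gradConst γ T) * (2 * C) * ε with hP
  have hP0 : 0 ≤ P := by positivity
  have hsum : a + b + c ≤ P * (1 + ‖x‖) ^ s := by
    calc a + b + c ≤ κ * (3 * (2 * C * ε) * (1 + ‖x‖) ^ s) := by linarith
      _ ≤ 16 * (8 * (1 + T) * gradConst γ T) * (3 * (2 * C * ε) * (1 + ‖x‖) ^ s) :=
        mul_le_mul_of_nonneg_right hκ (by positivity)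
      _ = P * (1 + ‖x‖) ^ s := by rw [hP]; ring
  have hD : decayConst γ T C * ε = P * (1 + T) ^ 2 := by
    rw [hP, decayConst]
    ring
  rw [hD]
  refine ⟨fun hq => hsum.trans ?_, fun hq => hsum.trans ?_⟩
  · have h1 := rpow_le_rpow_outside ht hs hq
    have h2 : 0 ≤ (1 + |‖x‖ - t|) ^ s := by positivity
    calc P * (1 + ‖x‖) ^ s ≤ P * (1 * (1 + |‖x‖ - t|) ^ s) := by
          rw [one_mul]
          gcongr
      _ ≤ P * ((1 + T) ^ 2 * (1 + |‖x‖ - t|) ^ s) := by gcongr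
      _ = _ := by ring
  · calc P * (1 + ‖x‖) ^ s ≤ P * ((1 + T) ^ 2 * (1 + |‖x‖ - t|) ^ s') := by
          gcongr
          exact rpow_le_rpow_inside htT hs hs' hq
      _ = _ := by ring

end Energy

end EYMH

end

theorem theorem5p1 (N : ℕ) (hN : 4 ≤ N) (γ μ : ℝ) (hγ : γ ∈ Set.Ioo (0 : ℝ) (1 / 2))
    (hμ : μ ∈ Set.Ioo (0 : ℝ) (1 / 2)) (T C : ℝ) (hT : 0 < T) (hC : 0 < C) :
    ∃ K : ℝ, 0 < K ∧ ∀ ε : ℝ, 0 < ε → ∀ Tstar : ℝ, 0 < Tstar → Tstar ≤ T →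
      ∀ (h : ℝ → EYMH.L2 EYMH.Tensor2) (A : ℝ → EYMH.L2 EYMH.GaugeForm)
        (Φ : ℝ → EYMH.L2 EYMH.Higgs),
        EYMH.MemE (N + 1) T h → EYMH.MemE (N + 1) T A → EYMH.MemE (N + 1) T Φ →
        (∀ t ∈ Set.Ico (0 : ℝ) Tstar,
          EYMH.energy N γ μ T h A Φ t ≤ ENNReal.ofReal (2 * C * ε)) →
        ∀ t ∈ Set.Ico (0 : ℝ) Tstar, ∀ I : List EYMH.VF, I.length + 3 ≤ N →
          ∃ (zh : EYMH.Space → EYMH.Tensor2) (zA : EYMH.Space → EYMH.GaugeForm)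
            (zΦ : EYMH.Space → EYMH.Higgs) (dh : EYMH.Space → EYMH.Grad EYMH.Tensor2)
            (dA : EYMH.Space → EYMH.Grad EYMH.GaugeForm)
            (dΦ : EYMH.Space → EYMH.Grad EYMH.Higgs),
            EYMH.IsContVersion zh (EYMH.zField T h I t) ∧
            EYMH.IsContVersion zA (EYMH.zField T A I t) ∧
            EYMH.IsContVersion zΦ (EYMH.zField T Φ I t) ∧
            EYMH.IsContVersion dh (EYMH.zGrad T h I t) ∧
            EYMH.IsContVersion dA (EYMH.zGrad T A I t) ∧
            EYMH.IsContVersion dΦ (EYMH.zGrad T Φ I t) ∧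
            (∀ x : EYMH.Space,
              (0 < ‖x‖ - t →
                ‖dh x‖ + ‖dA x‖ + ‖dΦ x‖ ≤ K * ε * (1 + |‖x‖ - t|) ^ (-2 - γ)) ∧
              (‖x‖ - t < 0 →
                ‖dh x‖ + ‖dA x‖ + ‖dΦ x‖ ≤ K * ε * (1 + |‖x‖ - t|) ^ (-(3 / 2) : ℝ))) ∧
            (∀ x : EYMH.Space,
              (0 < ‖x‖ - t →
                ‖zh x‖ + ‖zA x‖ + ‖zΦ x‖ ≤ K * ε * (1 + |‖x‖ - t|) ^ (-1 - γ)) ∧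
              (‖x‖ - t < 0 →
                ‖zh x‖ + ‖zA x‖ + ‖zΦ x‖ ≤ K * ε * (1 + |‖x‖ - t|) ^ (-(1 / 2) : ℝ))) ∧
            (I.length + 4 ≤ N → ∀ x : EYMH.Space, x ≠ 0 →
              (0 < ‖x‖ - t →
                ‖EYMH.tangential x (dh x)‖ + ‖EYMH.tangential x (dA x)‖ +
                    ‖EYMH.tangential x (dΦ x)‖ ≤ K * ε * (1 + |‖x‖ - t|) ^ (-2 - γ)) ∧
              (‖x‖ - t < 0 →
                ‖EYMH.tangential x (dh x)‖ + ‖EYMH.tangential x (dA x)‖ +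
                    ‖EYMH.tangential x (dΦ x)‖ ≤
                  K * ε * (1 + |‖x‖ - t|) ^ (-(3 / 2) : ℝ))) := by
  refine ⟨EYMH.decayConst γ T C, EYMH.decayConst_pos γ hT.le hC, ?_⟩
  intro ε hε Tstar _ hTT h A Φ hh hA hΦ hen t ht I hI
  have htT : t ∈ Set.Ico 0 T := ⟨ht.1, ht.2.trans_le hTT⟩
  have hE0 : 0 ≤ 2 * C * ε := by positivity
  have hT0 := hT.le
  have hK := EYMH.gradConst_pos γ hT0
  have hJ : ∀ J : List EYMH.VF, J.length ≤ N → EYMH.weightedNorm γ μ T h J t +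
      EYMH.weightedNorm γ μ T A J t + EYMH.weightedNorm γ μ T Φ J t
        ≤ ENNReal.ofReal (2 * C * ε) := fun J hJ =>
    (EYMH.weightedNorm_add_le_energy γ μ T h A Φ t hJ).trans (hen t ht)
  obtain ⟨zh, dh, hzh, hdh, hdhb, hzhb⟩ := EYMH.exists_contVersions hγ hE0 hh htT
    (fun J hJN => (le_self_add.trans le_self_add).trans (hJ J hJN)) hI
  obtain ⟨zA, dA, hzA, hdA, hdAb, hzAb⟩ := EYMH.exists_contVersions hγ hE0 hA htT
    (fun J hJN => (le_add_self.trans le_self_add).trans (hJ J hJN)) hI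
  obtain ⟨zΦ, dΦ, hzΦ, hdΦ, hdΦb, hzΦb⟩ := EYMH.exists_contVersions hγ hE0 hΦ htT
    (fun J hJN => le_add_self.trans (hJ J hJN)) hI
  have hγ0 := hγ.1
  have hK1 : EYMH.gradConst γ T ≤ (1 + T) * EYMH.gradConst γ T :=
    le_mul_of_one_le_left hK.le (by linarith)
  refine ⟨zh, zA, zΦ, dh, dA, dΦ, hzh, hzA, hzΦ, hdh, hdA, hdΦ, fun x => ?_, fun x => ?_,
    fun _ x _ => ?_⟩
  · exact EYMH.decay_in_q hT0 hC hε ht.1 htT.2.le (by linarith) ⟨by norm_num, by norm_num⟩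
      (by linarith) (hdhb x) (hdAb x) (hdΦb x)
  · exact EYMH.decay_in_q hT0 hC hε ht.1 htT.2.le (by linarith) ⟨by norm_num, by norm_num⟩
      (by linarith) (hzhb x) (hzAb x) (hzΦb x)
  · have htan : ∀ n d : ℝ, n ≤ 16 * d →
        d ≤ 4 * EYMH.gradConst γ T * (2 * C * ε) * (1 + ‖x‖) ^ (-2 - γ) →
        n ≤ 64 * EYMH.gradConst γ T * (2 * C * ε) * (1 + ‖x‖) ^ (-2 - γ) := fun n d h1 h2 => by
      linarith
    exact EYMH.decay_in_q hT0 hC hε ht.1 htT.2.le (by linarith) ⟨by norm_num, by norm_num⟩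
      (by linarith) (htan _ _ (EYMH.norm_tangential_le x _) (hdhb x))
      (htan _ _ (EYMH.norm_tangential_le x _) (hdAb x))
      (htan _ _ (EYMH.norm_tangential_le x _) (hdΦb x))
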